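/- Let $G$ be a connected compact metric graph with finite vertex set $V$ and finite, non-empty edge set $E$, without loops and without multiple edges; each edge $e$ is identified with an interval $[0,\ell_e]$, $0<\ell_e<\infty$, whose end points $0$ and $\ell_e$ correspond to the initial and the terminal vertex of $e$. For each $e\in E$ let $1<p_e<\infty$ and let $\gamma_e:\mathbb R\to\mathbb R$ be continuous and (strictly) increasing with $\gamma_e(\mathbb R)=\mathbb R$ and $\gamma_e(0)=0$. A function $u$ on $G$ is a family $([u]_e)_{e\in E}$ of functions on $(0,\ell_e)$, $\int_G u=\sum_{e}\int_0^{\ell_e}[u]_e\,dx$, and $L^1(G)$ is the space of those with $[u]_e\in L^1(0,\ell_e)$ for all $e$, with norm $\|u\|_1=\sum_e\|[u]_e\|_{L^1(0,\ell_e)}$. Let $\mathcal W^{1,\bar p}(G)$ be the space of all $u$ with $[u]_e\in W^{1,p_e}(0,\ell_e)$ for all $e$ whose continuous representatives on $[0,\ell_e]$ agree at common vertices; $u(\mathrm v)$ denotes the common value at $\mathrm v\in V$. For $f\in L^1(G)$ and $\omega\in\mathbb R^V$, a function $v\in L^1(G)$ is a weak solution of $(P^f_\omega)$ if there is $u\in\mathcal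 W^{1,\bar p}(G)$ with $[v]_e=\gamma_e([u]_e)$ a.e. for all $e$ and $$\int_G v\varphi\,dx+\sum_{e\in E}\int_0^{\ell_e}|[u]_e'|^{p_e-2}[u]_e'[\varphi]_e'\,dx=\int_G f\varphi\,dx+\sum_{\mathrm v\in V}\omega_{\mathrm v}\varphi(\mathrm v)\qquad\text{for all }\varphi\in\mathcal W^{1,\bar p}(G).$$ Let $X=L^1(G)\times\mathbb R^V$, with the norm $\|(v,\omega)\|=\|v\|_1+\sum_{\mathrm v\in V}|\omega_{\mathrm v}|$ and the componentwise (a.e.) order, and let $$\mathcal A=\{((v,0),(\tilde v,\omega))\in X\times X:\ v\text{ is a weak solution of }(P_\omega^{v+\tilde v})\}.$$ Then $\mathcal A$ is m-T-accretive in $X$, that is: 1. (accretivity) $\|x-\hat x\|\le\|x-\hat x+\lambda(y-\hat y)\|$ for all $(x,y),(\hat x,\hat y)\in\mathcal A$ and $\lambda\ge0$; 2. (range condition) $\mathrm{Ran}(I+\lambda\mathcal A)=X$ for all $\lambda>0$; 3. (T-accretivity) $\|(x-\hat x)^+\|\le\|(x-\hat x+\lambda(y-\hat y))^+\|$ for all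 $(x,y),(\hat x,\hat y)\in\mathcal A$ and $\lambda>0$. Moreover, the domain $D(\mathcal A)=\{x\in X:\exists y,\ (x,y)\in\mathcal A\}$ satisfies $\overline{D(\mathcal A)}=L^1(G)\times\{0\}$. -/

import Mathlib

open MeasureTheory Set
open scoped ENNReal ContDiff

/-! ### Banach lattice structure on `ℓᵖ`-type products -/

section WithLpLattice

variable {p : ℝ≥0∞} {α : Type*}

instance WithLp.instLEOfLE [LE α] : LE (WithLp p α) := ⟨fun x y => x.ofLp ≤ y.ofLp⟩

instance WithLp.instLTOfLT [LT α] : LT (WithLp p α) := ⟨fun x y => x.ofLp < y.ofLp⟩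

instance WithLp.instMaxOfMax [Max α] : Max (WithLp p α) :=
  ⟨fun x y => WithLp.toLp p (x.ofLp ⊔ y.ofLp)⟩

instance WithLp.instMinOfMin [Min α] : Min (WithLp p α) :=
  ⟨fun x y => WithLp.toLp p (x.ofLp ⊓ y.ofLp)⟩

/-- A finite product with an `ℓᵖ`-norm carries the componentwise order. -/
instance WithLp.instLatticeOfLattice [Lattice α] : Lattice (WithLp p α) :=
  Function.Injective.lattice WithLp.ofLp (WithLp.ofLp_injective p)
    Iff.rfl Iff.rfl (fun _ _ => rfl) (fun _ _ => rfl)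

theorem WithLp.ofLp_abs [Lattice α] [AddCommGroup α] (x : WithLp p α) :
    (|x|).ofLp = |x.ofLp| := rfl

instance WithLp.instIsOrderedAddMonoid [Lattice α] [AddCommGroup α] [IsOrderedAddMonoid α] :
    IsOrderedAddMonoid (WithLp p α) where
  add_le_add_left _ _ h c := add_le_add_left (α := α) h c.ofLp

instance PiLp.instHasSolidNormOne {ι : Type*} [Fintype ι] {β : ι → Type*}
    [∀ i, NormedAddCommGroup (β i)] [∀ i, Lattice (β i)] [∀ i, HasSolidNorm (β i)] :
    HasSolidNorm (PiLp 1 β) where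
  solid x y h := by
    rw [PiLp.norm_eq_of_L1, PiLp.norm_eq_of_L1]
    exact Finset.sum_le_sum fun i _ => HasSolidNorm.solid (h i)

instance WithLp.instHasSolidNormProdOne {β δ : Type*} [NormedAddCommGroup β] [Lattice β]
    [HasSolidNorm β] [NormedAddCommGroup δ] [Lattice δ] [HasSolidNorm δ] :
    HasSolidNorm (WithLp 1 (β × δ)) where
  solid x y h := by
    rw [WithLp.prod_norm_eq_of_L1, WithLp.prod_norm_eq_of_L1]
    exact add_le_add (HasSolidNorm.solid h.1) (HasSolidNorm.solid h.2)

end WithLpLattice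

/-! ### Multivalued operators, identified with their graphs in `X × X` -/

namespace NonlinearOperator

/-- The domain `D(A) = {u : A u ≠ ∅}`. -/
def domain {X : Type*} (A : Set (X × X)) : Set X := {u | ∃ v, (u, v) ∈ A}

/-- `A` is accretive. -/
def IsAccretive {X : Type*} [NormedAddCommGroup X] [NormedSpace ℝ X] (A : Set (X × X)) : Prop :=
  ∀ z ∈ A, ∀ z' ∈ A, ∀ lam : ℝ, 0 ≤ lam →
    ‖z.1 - z'.1‖ ≤ ‖z.1 - z'.1 + lam • (z.2 - z'.2)‖

/-- The range condition `Ran (I + λ A) = X` for every `λ > 0`. -/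
def RangeCondition {X : Type*} [NormedAddCommGroup X] [NormedSpace ℝ X]
    (A : Set (X × X)) : Prop :=
  ∀ lam : ℝ, 0 < lam → ∀ x : X, ∃ z ∈ A, z.1 + lam • z.2 = x

/-- `A` is m-accretive. -/
def IsMAccretive {X : Type*} [NormedAddCommGroup X] [NormedSpace ℝ X]
    (A : Set (X × X)) : Prop :=
  IsAccretive A ∧ RangeCondition A

/-- `A` is T-accretive in the Banach lattice `X`. -/
def IsTAccretive {X : Type*} [NormedAddCommGroup X] [NormedSpace ℝ X] [CompleteSpace X]
    [Lattice X] [IsOrderedAddMonoid X] [HasSolidNorm X] (A : Set (X × X)) : Prop :=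
  ∀ z ∈ A, ∀ z' ∈ A, ∀ lam : ℝ, 0 < lam →
    ‖(z.1 - z'.1)⁺‖ ≤ ‖(z.1 - z'.1 + lam • (z.2 - z'.2))⁺‖

/-- `A` is m-T-accretive: it is m-accretive and T-accretive. -/
def IsMTAccretive {X : Type*} [NormedAddCommGroup X] [NormedSpace ℝ X] [CompleteSpace X]
    [Lattice X] [IsOrderedAddMonoid X] [HasSolidNorm X] (A : Set (X × X)) : Prop :=
  IsMAccretive A ∧ IsTAccretive A

end NonlinearOperator

/-! ### Metric graphs and function spaces on them -/

/-- A metric graph with vertices `V` and edges `E`, connected, without loops and without multiple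
edges, all of whose edges have finite length; it is compact when `V` and `E` are finite.
The edge `e` is identified with the interval `[0, length e]`, its initial vertex `src e`
corresponding to `0` and its terminal vertex `tgt e` to `length e`. -/
structure MetricGraph (V E : Type*) where
  src : E → V
  tgt : E → V
  length : E → ℝ
  length_pos : ∀ e, 0 < length e
  loopless : ∀ e, src e ≠ tgt e
  no_multiple_edges : ∀ e e', s(src e, tgt e) = s(src e', tgt e') → e = e'
  connected : (SimpleGraph.fromRel fun a b => ∃ e, src e = a ∧ tgt e = b).Connected

/-- `du` is the weak derivative of `u` on the interval `(0, ℓ)`. -/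
def HasWeakDerivOnInterval (ℓ : ℝ) (u du : ℝ → ℝ) : Prop :=
  ∀ φ : ℝ → ℝ, ContDiff ℝ ∞ φ → HasCompactSupport φ → tsupport φ ⊆ Ioo 0 ℓ →
    ∫ x in Ioo 0 ℓ, u x * deriv φ x = - ∫ x in Ioo 0 ℓ, du x * φ x

namespace MetricGraph

variable {V E : Type*}

/-- Lebesgue measure on the edge `e`, that is on `(0, length e)`. -/
noncomputable abbrev edgeMeasure (G : MetricGraph V E) (e : E) : Measure ℝ :=
  volume.restrict (Ioo 0 (G.length e))

/-- `L¹(G)`: families of functions in `L¹(0, length e)`, normed by the sum of the `L¹`-norms. -/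
abbrev L1 (G : MetricGraph V E) : Type _ := PiLp 1 fun e : E => Lp ℝ 1 (G.edgeMeasure e)

/-- `X = L¹(G) × L¹(V)`, where `L¹(V)` is `ℝ^V` with the `1`-norm; the norm of the product is the
sum of the two norms, the order is the componentwise one. -/
abbrev X (G : MetricGraph V E) : Type _ := WithLp 1 (G.L1 × PiLp 1 fun _ : V => ℝ)

/-- An element of `𝒲^{1,p}(G)`: on each edge a function of `W^{1,p_e}(0, length e)`, given by its
continuous representative on `[0, length e]` together with its weak derivative, such that the
values at the end points agree at the vertices; `vertexValue` is the common value. -/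
structure W1 (G : MetricGraph V E) (p : E → ℝ) where
  toFun : E → ℝ → ℝ
  deriv : E → ℝ → ℝ
  vertexValue : V → ℝ
  memLp : ∀ e, MemLp (toFun e) (ENNReal.ofReal (p e)) (G.edgeMeasure e)
  memLp_deriv : ∀ e, MemLp (deriv e) (ENNReal.ofReal (p e)) (G.edgeMeasure e)
  hasWeakDeriv : ∀ e, HasWeakDerivOnInterval (G.length e) (toFun e) (deriv e)
  continuousOn : ∀ e, ContinuousOn (toFun e) (Icc 0 (G.length e))
  value_src : ∀ e, toFun e 0 = vertexValue (G.src e)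
  value_tgt : ∀ e, toFun e (G.length e) = vertexValue (G.tgt e)

variable [Fintype V] [Fintype E]

/-- `v` is a weak solution of the problem `(P_w^f)`: `v - Δ_p u = f` on the edges, `v = γ(u)`,
`u` continuous, with flux `w` at the vertices. -/
def IsWeakSolution (G : MetricGraph V E) (p : E → ℝ) (γ : E → ℝ → ℝ) (w : V → ℝ)
    (f v : G.L1) : Prop :=
  ∃ u : G.W1 p, (∀ e, v e =ᵐ[G.edgeMeasure e] fun x => γ e (u.toFun e x)) ∧
    ∀ φ : G.W1 p,
      (∑ e, ∫ x, v e x * φ.toFun e x ∂G.edgeMeasure e) +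
        (∑ e, ∫ x, |u.deriv e x| ^ (p e - 2) * u.deriv e x * φ.deriv e x ∂G.edgeMeasure e) =
      (∑ e, ∫ x, f e x * φ.toFun e x ∂G.edgeMeasure e) + ∑ a, w a * φ.vertexValue a

/-- The operator `𝒜` on `X`: `((v, 0), (v', w)) ∈ 𝒜` iff `v` is a weak solution of
`(P_w^{v + v'})`. -/
def opA (G : MetricGraph V E) (p : E → ℝ) (γ : E → ℝ → ℝ) : Set (G.X × G.X) :=
  {z | ∃ (v v' : G.L1) (w : PiLp 1 fun _ : V => ℝ),
    z = (WithLp.toLp 1 (v, 0), WithLp.toLp 1 (v', w)) ∧ G.IsWeakSolution p γ w (v + v') v}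

end MetricGraph

/-!
The heart of the matter is the equation `-Δ_p u = v'` on the edges with flux `w` at the vertices
(`MetricGraph.SolvesFlux`): a pair `((v, 0), (v', w))` belongs to `𝒜` exactly when `v = γ(u)` for a
solution `u` of it (`MetricGraph.isWeakSolution_add_iff`). Functions of `𝒲^{1,p}(G)` are handled
through the fact that, on each edge, they are primitives of their weak derivative
(`HasWeakDerivOnInterval.isPrimitiveOn`, the lemma of du Bois-Reymond); this gives the chain rule
for `H ∘ u`.

*T-accretivity.* Two solutions `u`, `û` are compared by testing the difference of their equations
with `H(u - û)`, where `H` is smooth, nondecreasing, `0 ≤ H ≤ 1`, and approximates the indicator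
function of `(0, ∞)`. The `p`-Laplacian contributes a nonnegative term, and in the limit `H`
selects the set `{u > û} = {γ(u) > γ(û)}`
(`MetricGraph.SolvesFlux.sum_integral_posPart_le`). Since the norm of `X` is additive on the
positive cone, T-accretivity in both directions gives accretivity.

*Range condition.* The resolvent equation is the Euler-Lagrange equation of the convex functional
`∑ₑ ∫ |u'|^p / p + ∫ Γ(u) - ∫ g u - ∑ η u(a)` with `Γ' = γ`, after `γ`, `g` and `η` have been divided
by `λ`. It is coercive, because `Γ` grows superlinearly (as `γ` is onto) and every vertex lies on an
edge (as `G` is connected with at least one edge): `MetricGraph.exists_le_energy`. Instead of weak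
compactness, uniform convexity of `Lᵖ` makes the derivatives of a minimizing sequence a Cauchy
sequence, and the vertex values live in a finite-dimensional space, so that the minimum is attained
(`MetricGraph.exists_energy_minimizer`).

*Density of the domain.* If `h ∈ 𝒲^{1,p}(G)`, testing the resolvent equation for `(γ(h), 0)` with
`u - h` bounds `∫ (γ(u) - γ(h)) (u - h)` by a multiple of `λ`; as `h` is bounded, this forces
`γ(u) → γ(h)` in `L¹` (`MetricGraph.toL1_mem_closure_domain`). Finally the functions `γ(h)` are
dense in `L¹(G)` by Weierstrass approximation (`exists_contDiff_integral_abs_sub_lt`).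
-/

open scoped Topology

/-! ### Primitives of integrable functions on an interval -/

/-- `u` is, on `[0, ℓ]`, a primitive of the integrable function `d`. This is the form in which a
function of `W^{1,1}(0, ℓ)`, with its continuous representative, is used. -/
def IsPrimitiveOn (ℓ : ℝ) (u d : ℝ → ℝ) : Prop :=
  IntervalIntegrable d volume 0 ℓ ∧ ∀ x ∈ Icc 0 ℓ, u x = u 0 + ∫ t in (0 : ℝ)..x, d t

namespace IsPrimitiveOn

variable {ℓ : ℝ} {u d v e : ℝ → ℝ}

theorem absolutelyContinuousOnInterval (h : IsPrimitiveOn ℓ u d) (hℓ : 0 < ℓ) :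
    AbsolutelyContinuousOnInterval u 0 ℓ := by
  have h1 := h.1.absolutelyContinuousOnInterval_intervalIntegral (c := 0) (by simp)
  have h2 : AbsolutelyContinuousOnInterval (fun _ : ℝ => u 0) 0 ℓ :=
    (contDiff_const.contDiffOn).absolutelyContinuousOnInterval
  have h3 := h2.add h1
  rw [absolutelyContinuousOnInterval_iff] at h3 ⊢
  intro ε hε
  obtain ⟨δ, hδ, H⟩ := h3 ε hε
  refine ⟨δ, hδ, fun E hE hs => ?_⟩
  refine lt_of_le_of_lt (le_of_eq ?_) (H E hE hs)
  refine Finset.sum_congr rfl fun i hi => ?_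
  have := hE.1 i hi
  rw [uIcc_of_le hℓ.le] at this
  rw [h.2 _ this.1, h.2 _ this.2]
  rfl

theorem continuousOn (h : IsPrimitiveOn ℓ u d) (hℓ : 0 < ℓ) : ContinuousOn u (Icc 0 ℓ) := by
  have := (h.absolutelyContinuousOnInterval hℓ).continuousOn
  rwa [uIcc_of_le hℓ.le] at this

theorem ae_hasDerivAt (h : IsPrimitiveOn ℓ u d) (hℓ : 0 < ℓ) :
    ∀ᵐ x, x ∈ Ioo 0 ℓ → HasDerivAt u (d x) x := by
  filter_upwards [h.1.ae_hasDerivAt_integral] with x hx hxI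
  have h1 := hx (by rw [uIcc_of_le hℓ.le]; exact Ioo_subset_Icc_self hxI) 0 (by simp)
  have h2 := h1.const_add (u 0)
  refine h2.congr_of_eventuallyEq ?_
  filter_upwards [isOpen_Ioo.mem_nhds hxI] with y hy using h.2 y (Ioo_subset_Icc_self hy)

theorem of_absolutelyContinuousOnInterval (hℓ : 0 < ℓ) (hu : AbsolutelyContinuousOnInterval u 0 ℓ)
    (hd : ∀ᵐ x, x ∈ Ioo 0 ℓ → HasDerivAt u (d x) x) : IsPrimitiveOn ℓ u d := by
  have hne : ∀ᵐ x : ℝ, x ≠ ℓ := by simp [ae_iff, measure_singleton]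
  have hae : ∀ᵐ x, x ∈ Ioc 0 ℓ → deriv u x = d x := by
    filter_upwards [hd, hne] with x hx h1 h2
    exact (hx ⟨h2.1, lt_of_le_of_ne h2.2 h1⟩).deriv
  refine ⟨?_, fun x hx => ?_⟩
  · refine hu.intervalIntegrable_deriv.congr_ae ?_
    rw [uIoc_of_le hℓ.le, Filter.EventuallyEq, ae_restrict_iff' measurableSet_Ioc]
    exact hae
  · have hsub : uIcc 0 x ⊆ uIcc 0 ℓ := by
      rw [uIcc_of_le hℓ.le, uIcc_of_le hx.1]; exact Icc_subset_Icc_right hx.2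
    have := (hu.mono hsub).integral_deriv_eq_sub
    have h2 : ∫ t in (0 : ℝ)..x, deriv u t = ∫ t in (0 : ℝ)..x, d t := by
      refine intervalIntegral.integral_congr_ae ?_
      filter_upwards [hae] with t ht h3
      rw [uIoc_of_le hx.1] at h3
      exact ht ⟨h3.1, h3.2.trans hx.2⟩
    linarith

theorem add (h : IsPrimitiveOn ℓ u d) (h' : IsPrimitiveOn ℓ v e) (hℓ : 0 < ℓ) :
    IsPrimitiveOn ℓ (fun x => u x + v x) (fun x => d x + e x) := by
  refine .of_absolutelyContinuousOnInterval hℓ ((h.absolutelyContinuousOnInterval hℓ).add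
    (h'.absolutelyContinuousOnInterval hℓ)) ?_
  filter_upwards [h.ae_hasDerivAt hℓ, h'.ae_hasDerivAt hℓ] with x h1 h2 hx
  exact (h1 hx).add (h2 hx)

theorem const_mul (h : IsPrimitiveOn ℓ u d) (hℓ : 0 < ℓ) (c : ℝ) :
    IsPrimitiveOn ℓ (fun x => c * u x) (fun x => c * d x) := by
  refine .of_absolutelyContinuousOnInterval hℓ
    ((h.absolutelyContinuousOnInterval hℓ).const_mul c) ?_
  filter_upwards [h.ae_hasDerivAt hℓ] with x h1 hx
  exact (h1 hx).const_mul c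

theorem of_contDiff (hℓ : 0 < ℓ) (hu : ContDiff ℝ 1 u) : IsPrimitiveOn ℓ u (deriv u) :=
  .of_absolutelyContinuousOnInterval hℓ hu.contDiffOn.absolutelyContinuousOnInterval
    (Filter.Eventually.of_forall fun x _ => (hu.differentiable one_ne_zero x).hasDerivAt)

/-- The chain rule for a `C¹` function of an absolutely continuous one. -/
theorem comp (h : IsPrimitiveOn ℓ u d) (hℓ : 0 < ℓ) {H : ℝ → ℝ} (hH : ContDiff ℝ 1 H) :
    IsPrimitiveOn ℓ (fun x => H (u x)) (fun x => deriv H (u x) * d x) := by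
  have hu := h.absolutelyContinuousOnInterval hℓ
  refine .of_absolutelyContinuousOnInterval hℓ ?_ ?_
  · obtain ⟨R, hR⟩ := hu.exists_bound
    obtain ⟨K, hK⟩ := (hH.contDiffOn (s := Icc (-R) R)).exists_lipschitzOnWith one_ne_zero
      (convex_Icc _ _) isCompact_Icc
    have hmem : ∀ x ∈ uIcc 0 ℓ, u x ∈ Icc (-R) R := fun x hx => abs_le.1 (hR x hx)
    rw [absolutelyContinuousOnInterval_iff] at hu ⊢
    intro ε hε
    obtain ⟨δ, hδ, H2⟩ := hu (ε / (K + 1)) (by positivity)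
    refine ⟨δ, hδ, fun E hE hs => ?_⟩
    have h1 := H2 E hE hs
    have h2 : ∑ i ∈ Finset.range E.1, dist (H (u (E.2 i).1)) (H (u (E.2 i).2)) ≤
        (K + 1) * ∑ i ∈ Finset.range E.1, dist (u (E.2 i).1) (u (E.2 i).2) := by
      rw [Finset.mul_sum]
      refine Finset.sum_le_sum fun i hi => ?_
      have h3 := hE.1 i hi
      refine (hK.dist_le_mul _ (hmem _ h3.1) _ (hmem _ h3.2)).trans ?_
      gcongr
      linarith
    refine h2.trans_lt ?_
    rw [lt_div_iff₀ (by positivity)] at h1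
    linarith
  · filter_upwards [h.ae_hasDerivAt hℓ] with x h1 hx
    exact ((hH.differentiable one_ne_zero (u x)).hasDerivAt).comp x (h1 hx)

theorem abs_sub_le (h : IsPrimitiveOn ℓ u d) {x : ℝ} (hx : x ∈ Icc 0 ℓ) :
    |u x - u 0| ≤ ∫ t in Ioo 0 ℓ, |d t| := by
  have hd : IntegrableOn d (Ioc 0 ℓ) := by
    simpa [uIoc_of_le (hx.1.trans hx.2)] using h.1.def'
  rw [h.2 x hx, add_sub_cancel_left, intervalIntegral.integral_of_le hx.1,
    ← integral_Ioc_eq_integral_Ioo]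
  refine (abs_integral_le_integral_abs).trans ?_
  exact setIntegral_mono_set hd.abs (Filter.Eventually.of_forall fun _ => abs_nonneg _)
    (Ioc_subset_Ioc_right hx.2).eventuallyLE

theorem hasWeakDerivOnInterval (h : IsPrimitiveOn ℓ u d) (hℓ : 0 < ℓ) :
    HasWeakDerivOnInterval ℓ u d := by
  intro φ hφ _ hsub
  have hφ' : ContDiff ℝ 1 φ := hφ.of_le (by exact_mod_cast le_top)
  have hφac : AbsolutelyContinuousOnInterval φ 0 ℓ := hφ'.contDiffOn.absolutelyContinuousOnInterval
  have hz : φ 0 = 0 ∧ φ ℓ = 0 := by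
    constructor <;> refine image_eq_zero_of_notMem_tsupport fun hc => ?_
    · exact lt_irrefl _ (hsub hc).1
    · exact lt_irrefl _ (hsub hc).2
  have key := (h.absolutelyContinuousOnInterval hℓ).integral_mul_deriv_eq_deriv_mul hφac
  rw [hz.1, hz.2, intervalIntegral.integral_of_le hℓ.le, intervalIntegral.integral_of_le hℓ.le,
    integral_Ioc_eq_integral_Ioo, integral_Ioc_eq_integral_Ioo] at key
  rw [key]
  simp only [mul_zero, sub_self, zero_sub, neg_inj]
  refine integral_congr_ae ?_
  rw [Filter.EventuallyEq, ae_restrict_iff' measurableSet_Ioo]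
  filter_upwards [h.ae_hasDerivAt hℓ] with x h1 hx
  rw [(h1 hx).deriv]

end IsPrimitiveOn

/-- The lemma of du Bois-Reymond: a continuous function with vanishing weak derivative is
constant. Every test function of integral zero is the derivative of a test function, so that `h`
minus its average against a fixed bump is orthogonal to all test functions. -/
theorem eq_of_hasWeakDerivOnInterval_zero {ℓ : ℝ} (hℓ : 0 < ℓ) {h : ℝ → ℝ}
    (hc : ContinuousOn h (Icc 0 ℓ)) (hw : HasWeakDerivOnInterval ℓ h fun _ => 0) :
    ∀ x ∈ Icc 0 ℓ, h x = h 0 := by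
  let b : ContDiffBump (ℓ / 2) := ⟨ℓ / 8, ℓ / 4, by positivity, by linarith⟩
  let ψ : ℝ → ℝ := b.normed volume
  have hψ : ContDiff ℝ ∞ ψ := b.contDiff_normed
  have hψc : HasCompactSupport ψ := b.hasCompactSupport_normed
  have hψs : tsupport ψ ⊆ Ioo 0 ℓ := by
    have : tsupport ψ = Metric.closedBall (ℓ / 2) (ℓ / 4) := b.tsupport_normed_eq
    rw [this, Real.closedBall_eq_Icc]
    intro x hx
    constructor <;> linarith [hx.1, hx.2]
  have hψ1 : ∫ x, ψ x = 1 := b.integral_normed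
  set c : ℝ := ∫ x in Ioo 0 ℓ, h x * ψ x
  have hhI : IntegrableOn h (Ioo 0 ℓ) :=
    (hc.integrableOn_Icc (μ := volume)).mono_set Ioo_subset_Icc_self
  have hint : ∀ g : ℝ → ℝ, Continuous g → HasCompactSupport g →
      IntegrableOn (fun x => h x * g x) (Ioo 0 ℓ) := fun g hg _ =>
    ((hc.mul hg.continuousOn).integrableOn_Icc (μ := volume)).mono_set Ioo_subset_Icc_self
  have hz : ∀ g : ℝ → ℝ, ContDiff ℝ ∞ g → HasCompactSupport g → tsupport g ⊆ Ioo 0 ℓ →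
      ∫ x, g x • (h x - c) = 0 := by
    intro g hg hgc hgs
    set m : ℝ := ∫ x, g x with hm
    let θ : ℝ → ℝ := fun x => g x - m * ψ x
    have hθ : ContDiff ℝ ∞ θ := hg.sub (contDiff_const.mul hψ)
    have hθc : Continuous θ := hθ.continuous
    have hθI : Integrable θ := (hg.continuous.integrable_of_hasCompactSupport hgc).sub
      ((hψ.continuous.integrable_of_hasCompactSupport hψc).const_mul m)
    have hθ0 : ∫ x, θ x = 0 := by
      rw [integral_sub (hg.continuous.integrable_of_hasCompactSupport hgc)
        ((hψ.continuous.integrable_of_hasCompactSupport hψc).const_mul m), integral_const_mul,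
        hψ1, hm]
      ring
    -- a compact interval inside `(0, ℓ)` off which `θ` vanishes
    obtain ⟨r, s, hr, hs, hrs⟩ : ∃ r s : ℝ, 0 < r ∧ s < ℓ ∧ ∀ x, x ∉ Icc r s → θ x = 0 := by
      have hK : IsCompact (tsupport g ∪ tsupport ψ) := hgc.isCompact.union hψc.isCompact
      have hne : (tsupport g ∪ tsupport ψ).Nonempty := by
        refine ⟨ℓ / 2, Or.inr ?_⟩
        have : tsupport ψ = Metric.closedBall (ℓ / 2) (ℓ / 4) := b.tsupport_normed_eq
        rw [this]
        exact Metric.mem_closedBall_self (by positivity)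
      have hsub : tsupport g ∪ tsupport ψ ⊆ Ioo 0 ℓ := union_subset hgs hψs
      obtain ⟨r, hr, hr'⟩ := hK.exists_isLeast hne
      obtain ⟨s, hs, hs'⟩ := hK.exists_isGreatest hne
      refine ⟨r, s, (hsub hr).1, (hsub hs).2, fun x hx => ?_⟩
      have hx' : x ∉ tsupport g ∪ tsupport ψ := fun h' => hx ⟨hr' h', hs' h'⟩
      rw [mem_union, not_or] at hx'
      simp [θ, image_eq_zero_of_notMem_tsupport hx'.1, image_eq_zero_of_notMem_tsupport hx'.2]
    let φ : ℝ → ℝ := fun x => ∫ t in (0 : ℝ)..x, θ t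
    have hφd : ∀ x, HasDerivAt φ (θ x) x := fun x => hθc.integral_hasStrictDerivAt 0 x |>.hasDerivAt
    have hφ' : deriv φ = θ := funext fun x => (hφd x).deriv
    have hφ : ContDiff ℝ ∞ φ := by
      rw [contDiff_infty_iff_deriv, hφ']
      exact ⟨fun x => (hφd x).differentiableAt, hθ⟩
    have hφ0 : ∀ x, x ∉ Icc r s → φ x = 0 := by
      intro x hx
      by_cases hxr : x < r
      · refine (intervalIntegral.integral_zero_ae (Filter.Eventually.of_forall fun t ht => ?_))
        refine hrs t fun hc => ?_
        rcases mem_uIoc.1 ht with h1 | h1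
        · linarith [h1.2, hc.1]
        · linarith [h1.2, hc.1]
      · have hxs : s < x := by
          by_contra hcon
          exact hx ⟨not_lt.1 hxr, not_lt.1 hcon⟩
        have hx0 : 0 ≤ x := by linarith [not_lt.1 hxr]
        have : ∫ t, θ t = ∫ t in Ioc 0 x, θ t := by
          refine (setIntegral_eq_integral_of_forall_compl_eq_zero fun t ht => ?_).symm
          exact hrs t fun hc => ht ⟨by linarith [hc.1], by linarith [hc.2]⟩
        change ∫ t in (0 : ℝ)..x, θ t = 0
        rw [intervalIntegral.integral_of_le hx0, ← this, hθ0]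
    have hφts : tsupport φ ⊆ Icc r s := by
      refine closure_minimal (fun x hx => ?_) isClosed_Icc
      by_contra hcon
      exact hx (hφ0 x hcon)
    have hφc : HasCompactSupport φ := isCompact_Icc.of_isClosed_subset (isClosed_tsupport φ) hφts
    have key := hw φ hφ hφc fun x hx => ⟨hr.trans_le (hφts hx).1, (hφts hx).2.trans_lt hs⟩
    rw [hφ'] at key
    simp only [zero_mul, integral_zero, neg_zero, θ] at key
    have h1 : ∫ x in Ioo 0 ℓ, h x * g x = m * c := by
      have h2 : ∫ x in Ioo 0 ℓ, h x * (g x - m * ψ x) =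
          (∫ x in Ioo 0 ℓ, h x * g x) - m * c := by
        rw [← integral_const_mul, ← integral_sub (hint g hg.continuous hgc)
          ((hint ψ hψ.continuous hψc).const_mul m)]
        congr 1
        ext x
        ring
      linarith
    have h3 : ∫ x, g x • (h x - c) = ∫ x in Ioo 0 ℓ, g x • (h x - c) := by
      refine (setIntegral_eq_integral_of_forall_compl_eq_zero fun t ht => ?_).symm
      rw [image_eq_zero_of_notMem_tsupport fun h' => ht (hgs h'), zero_smul]
    have h4 : m = ∫ x in Ioo 0 ℓ, g x := by
      refine (setIntegral_eq_integral_of_forall_compl_eq_zero fun t ht => ?_).symm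
      exact image_eq_zero_of_notMem_tsupport fun h' => ht (hgs h')
    have h5 : ∫ x in Ioo 0 ℓ, g x • (h x - c) =
        (∫ x in Ioo 0 ℓ, h x * g x) - c * ∫ x in Ioo 0 ℓ, g x := by
      rw [← integral_const_mul, ← integral_sub (hint g hg.continuous hgc)
        (((hg.continuous.integrable_of_hasCompactSupport hgc).integrableOn).const_mul c)]
      congr 1
      ext x
      simp only [smul_eq_mul]
      ring
    rw [h3, h5, h1, ← h4]
    ring
  have hae := isOpen_Ioo.ae_eq_zero_of_integral_contDiff_smul_eq_zero (U := Ioo 0 ℓ)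
    (f := fun x => h x - c) (μ := volume)
    ((hhI.sub (integrableOn_const (by simp))).locallyIntegrableOn) hz
  have heq : EqOn h (fun _ => c) (Icc 0 ℓ) := by
    refine Measure.eqOn_Icc_of_ae_eq volume hℓ.ne ?_ hc continuousOn_const
    rw [Filter.EventuallyEq, ← restrict_Ioo_eq_restrict_Icc, ae_restrict_iff' measurableSet_Ioo]
    filter_upwards [hae] with x h1 hx
    linarith [h1 hx]
  intro x hx
  rw [heq hx, heq (left_mem_Icc.2 hℓ.le)]

theorem HasWeakDerivOnInterval.isPrimitiveOn {ℓ : ℝ} (hℓ : 0 < ℓ) {u d : ℝ → ℝ}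
    (hd : IntegrableOn d (Ioo 0 ℓ)) (hc : ContinuousOn u (Icc 0 ℓ))
    (hw : HasWeakDerivOnInterval ℓ u d) : IsPrimitiveOn ℓ u d := by
  have hdI : IntervalIntegrable d volume 0 ℓ := by
    rw [intervalIntegrable_iff_integrableOn_Ioo_of_le hℓ.le]; exact hd
  let U : ℝ → ℝ := fun x => ∫ t in (0 : ℝ)..x, d t
  have hU : IsPrimitiveOn ℓ U d := ⟨hdI, fun x _ => by simp [U]⟩
  have hz : HasWeakDerivOnInterval ℓ (fun x => u x - U x) fun _ => 0 := by
    intro φ hφ hφc hsub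
    have h1 := hw φ hφ hφc hsub
    have h2 := hU.hasWeakDerivOnInterval hℓ φ hφ hφc hsub
    have hdφ : Continuous (deriv φ) := hφ.continuous_deriv (by exact_mod_cast le_top)
    have hi1 : IntegrableOn (fun x => u x * deriv φ x) (Ioo 0 ℓ) :=
      ((hc.mul hdφ.continuousOn).integrableOn_Icc (μ := volume)).mono_set Ioo_subset_Icc_self
    have hi2 : IntegrableOn (fun x => U x * deriv φ x) (Ioo 0 ℓ) :=
      (((hU.continuousOn hℓ).mul hdφ.continuousOn).integrableOn_Icc (μ := volume)).mono_set
        Ioo_subset_Icc_self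
    simp only [sub_mul, zero_mul, integral_zero, neg_zero]
    rw [integral_sub hi1 hi2, h1, h2]
    ring
  refine ⟨hdI, fun x hx => ?_⟩
  have := eq_of_hasWeakDerivOnInterval_zero hℓ (hc.sub (hU.continuousOn hℓ)) hz x hx
  simp only [U, Pi.sub_apply, intervalIntegral.integral_same] at this
  linarith

/-! ### The nonlinearity of the `p`-Laplacian -/

/-- The function `a ↦ |a|^(p-2) a`, the derivative of `a ↦ |a|^p / p`. -/
noncomputable def pFlux (p a : ℝ) : ℝ := |a| ^ (p - 2) * a

section pFlux

variable {p : ℝ}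

theorem pFlux_mul_self (hp : 1 < p) (a : ℝ) : pFlux p a * a = |a| ^ p := by
  rcases eq_or_ne a 0 with rfl | ha
  · simp [pFlux, Real.zero_rpow (by linarith : p ≠ 0)]
  · have h : 0 < |a| := abs_pos.2 ha
    rw [pFlux, mul_assoc, ← abs_mul_abs_self a, ← mul_assoc, ← Real.rpow_add_one h.ne',
      ← Real.rpow_add_one h.ne']
    congr 1
    ring

theorem abs_pFlux (hp : 1 < p) (a : ℝ) : |pFlux p a| = |a| ^ (p - 1) := by
  rcases eq_or_ne a 0 with rfl | ha
  · simp [pFlux, Real.zero_rpow (by linarith : p - 1 ≠ 0)]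
  · have h : 0 < |a| := abs_pos.2 ha
    rw [pFlux, abs_mul, abs_of_nonneg (by positivity : 0 ≤ |a| ^ (p - 2)),
      ← Real.rpow_add_one h.ne']
    congr 1
    ring

theorem continuous_pFlux (hp : 1 < p) : Continuous (pFlux p) := by
  have h1 : deriv (fun x : ℝ => ‖x‖ ^ p) = fun x => p * pFlux p x := by
    ext x
    rw [(hasDerivAt_norm_rpow x hp).deriv, pFlux, Real.norm_eq_abs, mul_assoc]
  have h2 : Continuous (deriv fun x : ℝ => ‖x‖ ^ p) :=
    (contDiff_norm_rpow (E := ℝ) hp).continuous_deriv le_rfl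
  rw [h1] at h2
  have h3 : pFlux p = fun x => p⁻¹ * (p * pFlux p x) := by
    ext x
    field_simp
  rw [h3]
  exact continuous_const.mul h2

/-- The tangent line inequality for the convex function `a ↦ |a|^p / p`. -/
theorem pFlux_mul_sub_le (hp : 1 < p) (a b : ℝ) :
    pFlux p a * (b - a) ≤ |b| ^ p / p - |a| ^ p / p := by
  have hq : (p / (p - 1)).HolderConjugate p := (Real.HolderConjugate.conjExponent hp).symm
  have h := Real.young_inequality_of_nonneg (abs_nonneg (pFlux p a)) (abs_nonneg b) hq
  have h1 : |pFlux p a| ^ (p / (p - 1)) = |a| ^ p := by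
    rw [abs_pFlux hp, ← Real.rpow_mul (abs_nonneg a), mul_div_cancel₀ _ (by linarith)]
  rw [h1] at h
  have h2 : |a| ^ p / (p / (p - 1)) = |a| ^ p - |a| ^ p / p := by
    have : p - 1 ≠ 0 := by linarith
    field_simp
  have h3 : pFlux p a * b ≤ |pFlux p a| * |b| := by
    rw [← abs_mul]; exact le_abs_self _
  rw [mul_sub, pFlux_mul_self hp]
  linarith

theorem pFlux_monotone (hp : 1 < p) (a b : ℝ) : 0 ≤ (pFlux p a - pFlux p b) * (a - b) := by
  have h1 := pFlux_mul_sub_le hp a b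
  have h2 := pFlux_mul_sub_le hp b a
  nlinarith

theorem abs_pFlux_mul_le (hp : 1 < p) (a b : ℝ) : |pFlux p a * b| ≤ |a| ^ p + |b| ^ p := by
  rw [abs_mul, abs_pFlux hp]
  have key : ∀ c : ℝ, 0 ≤ c → c ^ (p - 1) * c = c ^ p := by
    intro c hc
    rcases hc.eq_or_lt with rfl | h
    · simp [Real.zero_rpow (by linarith : p ≠ 0)]
    · rw [← Real.rpow_add_one h.ne']; congr 1; ring
  have ha := Real.rpow_nonneg (abs_nonneg a) p
  have hb := Real.rpow_nonneg (abs_nonneg b) p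
  rcases le_total |a| |b| with h | h
  · have : |a| ^ (p - 1) * |b| ≤ |b| ^ (p - 1) * |b| := by gcongr
    rw [key _ (abs_nonneg b)] at this
    linarith
  · have : |a| ^ (p - 1) * |b| ≤ |a| ^ (p - 1) * |a| := by gcongr
    rw [key _ (abs_nonneg a)] at this
    linarith

theorem abs_add_div_two_rpow_le (hp : 1 < p) (a b : ℝ) :
    |(a + b) / 2| ^ p ≤ (|a| ^ p + |b| ^ p) / 2 := by
  have h := (convexOn_rpow hp.le).2 (abs_nonneg a : |a| ∈ Ici 0) (abs_nonneg b : |b| ∈ Ici 0)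
    (by norm_num : (0 : ℝ) ≤ 1 / 2) (by norm_num : (0 : ℝ) ≤ 1 / 2) (by norm_num)
  simp only [smul_eq_mul] at h
  have h2 : |(a + b) / 2| ≤ 1 / 2 * |a| + 1 / 2 * |b| := by
    rw [abs_div, abs_two]; linarith [abs_add_le a b]
  have := Real.rpow_le_rpow (abs_nonneg _) h2 (by linarith : 0 ≤ p)
  linarith

theorem abs_add_div_two_rpow_lt (hp : 1 < p) {a b : ℝ} (hab : a ≠ b) :
    |(a + b) / 2| ^ p < (|a| ^ p + |b| ^ p) / 2 := by
  by_cases h : |a| = |b|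
  · have hb : a = -b := (abs_eq_abs.1 h).resolve_left hab
    have hb0 : b ≠ 0 := by rintro rfl; simp [hb] at hab
    have : 0 < |b| ^ p := Real.rpow_pos_of_pos (abs_pos.2 hb0) p
    subst hb
    simp only [neg_add_cancel, zero_div, abs_zero, abs_neg]
    rw [Real.zero_rpow (by linarith)]
    linarith
  · have h1 := (strictConvexOn_rpow hp).2 (abs_nonneg a : |a| ∈ Ici 0)
      (abs_nonneg b : |b| ∈ Ici 0) h
      (by norm_num : (0 : ℝ) < 1 / 2) (by norm_num : (0 : ℝ) < 1 / 2) (by norm_num)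
    simp only [smul_eq_mul] at h1
    have h2 : |(a + b) / 2| ≤ 1 / 2 * |a| + 1 / 2 * |b| := by
      rw [abs_div, abs_two]; linarith [abs_add_le a b]
    have := Real.rpow_le_rpow (abs_nonneg _) h2 (by linarith : 0 ≤ p)
    linarith

/-- Uniform convexity of `a ↦ |a|^p`, in a form that integrates to uniform convexity of `Lᵖ` for
every `p > 1`. By homogeneity it suffices to consider a compact set of pairs `(a, b)`, on which the
convexity defect is bounded below as soon as `|a - b|^p` exceeds `ε (|a|^p + |b|^p)`. -/
theorem exists_abs_sub_rpow_le (hp : 1 < p) {ε : ℝ} (hε : 0 < ε) :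
    ∃ C : ℝ, 0 ≤ C ∧ ∀ a b : ℝ, |a - b| ^ p ≤
      ε * (|a| ^ p + |b| ^ p) + C * ((|a| ^ p + |b| ^ p) / 2 - |(a + b) / 2| ^ p) := by
  have hp0 : 0 ≤ p := by linarith
  have hc : ∀ f : ℝ × ℝ → ℝ, Continuous f → Continuous fun z => |f z| ^ p := fun f hf =>
    hf.abs.rpow_const fun _ => Or.inr hp0
  let F : ℝ × ℝ → ℝ := fun z => |z.1 - z.2| ^ p - ε * (|z.1| ^ p + |z.2| ^ p)
  let D : ℝ × ℝ → ℝ := fun z => (|z.1| ^ p + |z.2| ^ p) / 2 - |(z.1 + z.2) / 2| ^ p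
  have hF : Continuous F := (hc _ (continuous_fst.sub continuous_snd)).sub
    (continuous_const.mul ((hc _ continuous_fst).add (hc _ continuous_snd)))
  have hD : Continuous D := (((hc _ continuous_fst).add (hc _ continuous_snd)).div_const _).sub
    (hc _ ((continuous_fst.add continuous_snd).div_const _))
  have hDn : ∀ z, 0 ≤ D z := fun z => sub_nonneg.2 (abs_add_div_two_rpow_le hp _ _)
  let S : Set (ℝ × ℝ) := Metric.sphere 0 1 ∩ {z | 0 ≤ F z}
  have hS : IsCompact S := (isCompact_sphere _ _).inter_right (isClosed_le continuous_const hF)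
  have hDS : ∀ z ∈ S, 0 < D z := by
    rintro ⟨a, b⟩ ⟨h1, h2⟩
    refine sub_pos.2 (abs_add_div_two_rpow_lt hp ?_)
    intro hab
    have hab' : a = b := hab
    subst hab'
    simp only [F, mem_ofPred_eq, sub_self, abs_zero, Real.zero_rpow (by linarith : p ≠ 0)] at h2
    have h3 : ‖(a, a)‖ = 1 := by simpa using h1
    have h4 : |a| = 1 := by simpa [Prod.norm_def] using h3
    rw [h4] at h2
    norm_num at h2
    linarith
  obtain ⟨C, hC0, hC⟩ : ∃ C : ℝ, 0 ≤ C ∧ ∀ z ∈ S, F z ≤ C * D z := by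
    have hcont : ContinuousOn (fun z => F z / D z) S :=
      hF.continuousOn.div hD.continuousOn fun z hz => (hDS z hz).ne'
    obtain ⟨C, hC⟩ := hS.exists_bound_of_continuousOn hcont
    refine ⟨|C|, abs_nonneg C, fun z hz => ?_⟩
    have h1 := (le_abs_self _).trans ((hC z hz).trans (le_abs_self C))
    rwa [div_le_iff₀ (hDS z hz)] at h1
  have hsphere : ∀ z ∈ Metric.sphere (0 : ℝ × ℝ) 1, F z ≤ C * D z := by
    intro z hz
    by_cases h : 0 ≤ F z
    · exact hC z ⟨hz, h⟩
    · exact (not_le.1 h).le.trans (mul_nonneg hC0 (hDn z))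
  refine ⟨C, hC0, fun a b => ?_⟩
  suffices H : F (a, b) ≤ C * D (a, b) by simp only [F, D] at H; linarith
  rcases eq_or_ne ((a, b) : ℝ × ℝ) 0 with h0 | h0
  · have ha : a = 0 := congrArg Prod.fst h0
    have hb : b = 0 := congrArg Prod.snd h0
    rw [ha, hb]
    simp [F, D, Real.zero_rpow (by linarith : p ≠ 0)]
  · set r := ‖((a, b) : ℝ × ℝ)‖ with hr
    have hr0 : 0 < r := norm_pos_iff.2 h0
    have hz : ((r⁻¹ * a, r⁻¹ * b) : ℝ × ℝ) ∈ Metric.sphere (0 : ℝ × ℝ) 1 := by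
      have : ((r⁻¹ * a, r⁻¹ * b) : ℝ × ℝ) = r⁻¹ • ((a, b) : ℝ × ℝ) := rfl
      rw [mem_sphere_zero_iff_norm, this, norm_smul, norm_inv, norm_norm, ← hr]
      field_simp
    have hscale : ∀ x : ℝ, |r⁻¹ * x| ^ p = (r⁻¹) ^ p * |x| ^ p := by
      intro x
      rw [abs_mul, abs_of_pos (inv_pos.2 hr0), Real.mul_rpow (inv_pos.2 hr0).le (abs_nonneg x)]
    have h1 := hsphere _ hz
    have e1 : F (r⁻¹ * a, r⁻¹ * b) = (r⁻¹) ^ p * F (a, b) := by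
      simp only [F, ← mul_sub, hscale]; ring
    have e2 : D (r⁻¹ * a, r⁻¹ * b) = (r⁻¹) ^ p * D (a, b) := by
      simp only [D, ← mul_add, mul_div_assoc, hscale]; ring
    rw [e1, e2] at h1
    have hpos : 0 < (r⁻¹) ^ p := Real.rpow_pos_of_pos (inv_pos.2 hr0) p
    have h2 : (r⁻¹) ^ p * F (a, b) ≤ (r⁻¹) ^ p * (C * D (a, b)) := by linarith
    exact le_of_mul_le_mul_left h2 hpos

end pFlux

/-! ### Sobolev functions on a metric graph -/

theorem ContinuousOn.memLp_Ioo {ℓ : ℝ} {f : ℝ → ℝ} (hf : ContinuousOn f (Icc 0 ℓ)) (q : ℝ≥0∞) :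
    MemLp f q (volume.restrict (Ioo 0 ℓ)) := by
  obtain ⟨R, hR⟩ := isCompact_Icc.exists_bound_of_continuousOn hf
  refine MemLp.of_bound ((hf.mono Ioo_subset_Icc_self).aestronglyMeasurable measurableSet_Ioo) R ?_
  rw [ae_restrict_iff' measurableSet_Ioo]
  exact Filter.Eventually.of_forall fun x hx => hR x (Ioo_subset_Icc_self hx)

namespace MetricGraph

variable {V E : Type*} {G : MetricGraph V E} {p : E → ℝ}

theorem integrable_mul_of_continuousOn {e : E} {f g : ℝ → ℝ} (hf : Integrable f (G.edgeMeasure e))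
    (hg : ContinuousOn g (Icc 0 (G.length e))) :
    Integrable (fun x => f x * g x) (G.edgeMeasure e) := by
  obtain ⟨R, hR⟩ := isCompact_Icc.exists_bound_of_continuousOn hg
  refine hf.mul_bdd (c := R)
    ((hg.mono Ioo_subset_Icc_self).aestronglyMeasurable measurableSet_Ioo) ?_
  rw [ae_restrict_iff' measurableSet_Ioo]
  exact Filter.Eventually.of_forall fun x hx => hR x (Ioo_subset_Icc_self hx)

theorem L1.integrable (f : G.L1) (e : E) : Integrable (f e) (G.edgeMeasure e) :=
  L1.integrable_coeFn _

theorem one_le_ofReal_exponent (hp : ∀ e, 1 < p e) (e : E) : 1 ≤ ENNReal.ofReal (p e) := by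
  rw [← ENNReal.ofReal_one]
  exact ENNReal.ofReal_le_ofReal (hp e).le

theorem intervalIntegrable_of_memLp (hp : ∀ e, 1 < p e) {e : E} {d : ℝ → ℝ}
    (hd : MemLp d (ENNReal.ofReal (p e)) (G.edgeMeasure e)) :
    IntervalIntegrable d volume 0 (G.length e) := by
  rw [intervalIntegrable_iff_integrableOn_Ioo_of_le (G.length_pos e).le]
  exact hd.integrable (one_le_ofReal_exponent hp e)

theorem integrable_abs_rpow (hp : ∀ e, 1 < p e) {e : E} {d : ℝ → ℝ}
    (hd : MemLp d (ENNReal.ofReal (p e)) (G.edgeMeasure e)) :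
    Integrable (fun x => |d x| ^ p e) (G.edgeMeasure e) := by
  have h0 : 0 < p e := one_pos.trans (hp e)
  have := hd.integrable_norm_rpow (by simpa using h0) (by simp)
  rwa [ENNReal.toReal_ofReal h0.le] at this

theorem integrable_pFlux_mul (hp : ∀ e, 1 < p e) {e : E} {d d' : ℝ → ℝ}
    (hd : MemLp d (ENNReal.ofReal (p e)) (G.edgeMeasure e))
    (hd' : MemLp d' (ENNReal.ofReal (p e)) (G.edgeMeasure e)) :
    Integrable (fun x => pFlux (p e) (d x) * d' x) (G.edgeMeasure e) := by
  refine ((integrable_abs_rpow hp hd).add (integrable_abs_rpow hp hd')).mono'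
    (((continuous_pFlux (hp e)).comp_aestronglyMeasurable hd.1).mul hd'.1) ?_
  exact Filter.Eventually.of_forall fun x => abs_pFlux_mul_le (hp e) _ _

namespace W1

theorem isPrimitiveOn (hp : ∀ e, 1 < p e) (u : G.W1 p) (e : E) :
    IsPrimitiveOn (G.length e) (u.toFun e) (u.deriv e) :=
  (u.hasWeakDeriv e).isPrimitiveOn (G.length_pos e)
    ((u.memLp_deriv e).integrable (one_le_ofReal_exponent hp e)) (u.continuousOn e)

/-- The element of `𝒲^{1,p}(G)` given on each edge by a primitive of an `L^{p_e}` function. -/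
noncomputable def ofPrimitive (f d : E → ℝ → ℝ) (c : V → ℝ)
    (hd : ∀ e, MemLp (d e) (ENNReal.ofReal (p e)) (G.edgeMeasure e))
    (h : ∀ e, IsPrimitiveOn (G.length e) (f e) (d e)) (hs : ∀ e, f e 0 = c (G.src e))
    (ht : ∀ e, f e (G.length e) = c (G.tgt e)) : G.W1 p where
  toFun := f
  deriv := d
  vertexValue := c
  memLp e := ((h e).continuousOn (G.length_pos e)).memLp_Ioo _
  memLp_deriv := hd
  hasWeakDeriv e := (h e).hasWeakDerivOnInterval (G.length_pos e)
  continuousOn e := (h e).continuousOn (G.length_pos e)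
  value_src := hs
  value_tgt := ht

/-- The combination `u + c v` of elements of `𝒲^{1,p}(G)`. -/
noncomputable def addMul (hp : ∀ e, 1 < p e) (u : G.W1 p) (c : ℝ) (v : G.W1 p) : G.W1 p :=
  ofPrimitive (fun e x => u.toFun e x + c * v.toFun e x) (fun e x => u.deriv e x + c * v.deriv e x)
    (fun a => u.vertexValue a + c * v.vertexValue a)
    (fun e => (u.memLp_deriv e).add ((v.memLp_deriv e).const_mul c))
    (fun e => (u.isPrimitiveOn hp e).add ((v.isPrimitiveOn hp e).const_mul (G.length_pos e) c)
      (G.length_pos e))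
    (fun e => by simp only [u.value_src, v.value_src])
    (fun e => by simp only [u.value_tgt, v.value_tgt])

/-- The composition `H ∘ u` of a `C¹` function with an element of `𝒲^{1,p}(G)`. -/
noncomputable def comp (hp : ∀ e, 1 < p e) (u : G.W1 p) (H : ℝ → ℝ) (hH : ContDiff ℝ 1 H) : G.W1 p :=
  ofPrimitive (fun e x => H (u.toFun e x)) (fun e x => _root_.deriv H (u.toFun e x) * u.deriv e x)
    (fun a => H (u.vertexValue a))
    (fun e => by
      have hc : ContinuousOn (fun x => _root_.deriv H (u.toFun e x)) (Icc 0 (G.length e)) :=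
        (hH.continuous_deriv le_rfl).comp_continuousOn (u.continuousOn e)
      exact (u.memLp_deriv e).mul' (hc.memLp_Ioo ∞))
    (fun e => (u.isPrimitiveOn hp e).comp (G.length_pos e) hH)
    (fun e => by simp only [u.value_src]) (fun e => by simp only [u.value_tgt])

end W1

variable [Fintype V] [Fintype E]

/-- The weak form of `-Δ_p u = f` on the edges, with flux `w` at the vertices. -/
def SolvesFlux (u : G.W1 p) (f : E → ℝ → ℝ) (w : V → ℝ) : Prop :=
  ∀ φ : G.W1 p, ∑ e, ∫ x, pFlux (p e) (u.deriv e x) * φ.deriv e x ∂G.edgeMeasure e =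
    (∑ e, ∫ x, f e x * φ.toFun e x ∂G.edgeMeasure e) + ∑ a, w a * φ.vertexValue a

theorem isWeakSolution_add_iff {γ : E → ℝ → ℝ} {w : V → ℝ} {v v' : G.L1} :
    G.IsWeakSolution p γ w (v + v') v ↔ ∃ u : G.W1 p,
      (∀ e, v e =ᵐ[G.edgeMeasure e] fun x => γ e (u.toFun e x)) ∧
        SolvesFlux u (fun e => v' e) w := by
  refine exists_congr fun u => and_congr_right fun _ => forall_congr' fun φ => ?_
  have h : ∀ e, ∫ x, (v + v') e x * φ.toFun e x ∂G.edgeMeasure e =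
      (∫ x, v e x * φ.toFun e x ∂G.edgeMeasure e) +
        ∫ x, v' e x * φ.toFun e x ∂G.edgeMeasure e := by
    intro e
    rw [← integral_add (integrable_mul_of_continuousOn (v.integrable e) (φ.continuousOn e))
      (integrable_mul_of_continuousOn (v'.integrable e) (φ.continuousOn e))]
    refine integral_congr_ae ?_
    filter_upwards [Lp.coeFn_add (v e) (v' e)] with x hx
    have : (v + v') e x = v e x + v' e x := hx
    rw [this]
    ring
  simp only [h, Finset.sum_add_distrib, pFlux]
  constructor <;> intro h' <;> linarith

end MetricGraph

/-! ### T-accretivity -/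

namespace MetricGraph

variable {V E : Type*} {G : MetricGraph V E} {p : E → ℝ}

theorem norm_L1_posPart_apply (e : E) (g : Lp ℝ 1 (G.edgeMeasure e)) :
    ‖g ⊔ 0‖ = ∫ x, max (g x) 0 ∂G.edgeMeasure e := by
  rw [L1.norm_eq_integral_norm]
  refine integral_congr_ae ?_
  filter_upwards [Lp.coeFn_sup g 0, Lp.coeFn_zero ℝ 1 (G.edgeMeasure e)] with x h1 h2
  rw [h1, Pi.sup_apply, h2, Real.norm_eq_abs]
  exact abs_of_nonneg (le_max_right _ _)

variable [Fintype V] [Fintype E]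

/-- The difference of two weak forms, tested with a nondecreasing `C¹` function of `u - û`: the
`p`-Laplacian contributes a nonnegative term. -/
theorem SolvesFlux.sum_comp_sub_nonneg (hp : ∀ e, 1 < p e) {u u' : G.W1 p} {f f' : G.L1}
    {w w' : V → ℝ} (h : SolvesFlux u (fun e => f e) w) (h' : SolvesFlux u' (fun e => f' e) w')
    {H : ℝ → ℝ} (hH : ContDiff ℝ 1 H) (hmono : Monotone H) :
    0 ≤ (∑ e, ∫ x, (f e x - f' e x) * H (u.toFun e x - u'.toFun e x) ∂G.edgeMeasure e) +
      ∑ a, (w a - w' a) * H (u.vertexValue a - u'.vertexValue a) := by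
  let φ : G.W1 p := (u.addMul hp (-1) u').comp hp H hH
  have hφ : ∀ e x, φ.toFun e x = H (u.toFun e x - u'.toFun e x) := fun e x => by
    change H (u.toFun e x + -1 * u'.toFun e x) = _
    rw [neg_one_mul, ← sub_eq_add_neg]
  have hφv : ∀ a, φ.vertexValue a = H (u.vertexValue a - u'.vertexValue a) := fun a => by
    change H (u.vertexValue a + -1 * u'.vertexValue a) = _
    rw [neg_one_mul, ← sub_eq_add_neg]
  have hφd : ∀ e x, φ.deriv e x =
      deriv H (u.toFun e x + -1 * u'.toFun e x) * (u.deriv e x + -1 * u'.deriv e x) :=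
    fun e x => rfl
  have h1 := h φ
  have h2 := h' φ
  have hflux : 0 ≤ (∑ e, ∫ x, pFlux (p e) (u.deriv e x) * φ.deriv e x ∂G.edgeMeasure e) -
      ∑ e, ∫ x, pFlux (p e) (u'.deriv e x) * φ.deriv e x ∂G.edgeMeasure e := by
    rw [← Finset.sum_sub_distrib]
    refine Finset.sum_nonneg fun e _ => ?_
    rw [← integral_sub (integrable_pFlux_mul hp (u.memLp_deriv e) (φ.memLp_deriv e))
      (integrable_pFlux_mul hp (u'.memLp_deriv e) (φ.memLp_deriv e))]
    refine integral_nonneg fun x => ?_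
    have h3 : 0 ≤ deriv H (u.toFun e x + -1 * u'.toFun e x) := hmono.deriv_nonneg
    have h4 := mul_nonneg h3 (pFlux_monotone (hp e) (u.deriv e x) (u'.deriv e x))
    simp only [Pi.zero_apply, hφd]
    linarith
  have hdiff : (∑ e, ∫ x, (f e x - f' e x) * φ.toFun e x ∂G.edgeMeasure e) =
      (∑ e, ∫ x, f e x * φ.toFun e x ∂G.edgeMeasure e) -
        ∑ e, ∫ x, f' e x * φ.toFun e x ∂G.edgeMeasure e := by
    rw [← Finset.sum_sub_distrib]
    refine Finset.sum_congr rfl fun e _ => ?_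
    rw [← integral_sub (integrable_mul_of_continuousOn (f.integrable e) (φ.continuousOn e))
      (integrable_mul_of_continuousOn (f'.integrable e) (φ.continuousOn e))]
    simp only [sub_mul]
  have hdiffv : ∑ a, (w a - w' a) * φ.vertexValue a =
      (∑ a, w a * φ.vertexValue a) - ∑ a, w' a * φ.vertexValue a := by
    rw [← Finset.sum_sub_distrib]
    simp only [sub_mul]
  have key : 0 ≤ (∑ e, ∫ x, (f e x - f' e x) * φ.toFun e x ∂G.edgeMeasure e) +
      ∑ a, (w a - w' a) * φ.vertexValue a := by
    rw [hdiff, hdiffv]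
    linarith
  simpa only [hφ, hφv] using key

/-- The contraction estimate in `L¹`. The test functions are smooth approximations of the indicator
function of `{u > û}`, which is the set where `γ(u) > γ(û)`. -/
theorem SolvesFlux.sum_integral_posPart_le (hp : ∀ e, 1 < p e) {γ : E → ℝ → ℝ}
    (hγ : ∀ e, StrictMono (γ e)) {u u' : G.W1 p} {v v' f f' : G.L1} {w w' : V → ℝ}
    (hv : ∀ e, v e =ᵐ[G.edgeMeasure e] fun x => γ e (u.toFun e x))
    (hv' : ∀ e, v' e =ᵐ[G.edgeMeasure e] fun x => γ e (u'.toFun e x))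
    (h : SolvesFlux u (fun e => f e) w) (h' : SolvesFlux u' (fun e => f' e) w')
    {lam : ℝ} (hlam : 0 ≤ lam) :
    ∑ e, ∫ x, max (v e x - v' e x) 0 ∂G.edgeMeasure e ≤
      (∑ e, ∫ x, max (v e x - v' e x + lam * (f e x - f' e x)) 0 ∂G.edgeMeasure e) +
        ∑ a, max (lam * (w a - w' a)) 0 := by
  let H : ℕ → ℝ → ℝ := fun n s => Real.smoothTransition (n * s)
  have hH : ∀ n, ContDiff ℝ 1 (H n) := fun n =>
    Real.smoothTransition.contDiff.comp (contDiff_const.mul contDiff_id)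
  have hHmono : ∀ n, Monotone (H n) := fun n =>
    Real.smoothTransition.monotone.comp fun s t hst => by
      change (n : ℝ) * s ≤ n * t
      gcongr
  have hH0 : ∀ n s, 0 ≤ H n s := fun n s => Real.smoothTransition.nonneg _
  have hH1 : ∀ n s, H n s ≤ 1 := fun n s => Real.smoothTransition.le_one _
  have hle : ∀ n (a s : ℝ), a * H n s ≤ max a 0 := fun n a s => by
    rcases le_total 0 a with ha | ha
    · rw [max_eq_left ha]; exact mul_le_of_le_one_right ha (hH1 n s)
    · rw [max_eq_right ha]; exact mul_nonpos_of_nonpos_of_nonneg ha (hH0 n s)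
  have hcont : ∀ e, ContinuousOn (fun x => u.toFun e x - u'.toFun e x) (Icc 0 (G.length e)) :=
    fun e => (u.continuousOn e).sub (u'.continuousOn e)
  have hHc : ∀ n e, ContinuousOn (fun x => H n (u.toFun e x - u'.toFun e x))
      (Icc 0 (G.length e)) := fun n e => (hH n).continuous.comp_continuousOn (hcont e)
  have hiv : ∀ e, Integrable (fun x => v e x - v' e x) (G.edgeMeasure e) := fun e =>
    (v.integrable e).sub (v'.integrable e)
  have hif : ∀ e, Integrable (fun x => f e x - f' e x) (G.edgeMeasure e) := fun e =>
    (f.integrable e).sub (f'.integrable e)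
  have hbound : ∀ n : ℕ,
      ∑ e, ∫ x, (v e x - v' e x) * H n (u.toFun e x - u'.toFun e x) ∂G.edgeMeasure e ≤
      (∑ e, ∫ x, max (v e x - v' e x + lam * (f e x - f' e x)) 0 ∂G.edgeMeasure e) +
        ∑ a, max (lam * (w a - w' a)) 0 := by
    intro n
    have h0 := mul_nonneg hlam (h.sum_comp_sub_nonneg hp h' (hH n) (hHmono n))
    have h1 : ∑ a, lam * ((w a - w' a) * H n (u.vertexValue a - u'.vertexValue a)) ≤
        ∑ a, max (lam * (w a - w' a)) 0 :=
      Finset.sum_le_sum fun a _ => by rw [← mul_assoc]; exact hle _ _ _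
    have h2 : (∑ e, ∫ x, (v e x - v' e x) * H n (u.toFun e x - u'.toFun e x) ∂G.edgeMeasure e) +
        ∑ e, lam * ∫ x, (f e x - f' e x) * H n (u.toFun e x - u'.toFun e x) ∂G.edgeMeasure e ≤
        ∑ e, ∫ x, max (v e x - v' e x + lam * (f e x - f' e x)) 0 ∂G.edgeMeasure e := by
      rw [← Finset.sum_add_distrib]
      refine Finset.sum_le_sum fun e _ => ?_
      rw [← integral_const_mul, ← integral_add (integrable_mul_of_continuousOn (hiv e) (hHc n e))
        ((integrable_mul_of_continuousOn (hif e) (hHc n e)).const_mul lam)]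
      refine integral_mono ((integrable_mul_of_continuousOn (hiv e) (hHc n e)).add
        ((integrable_mul_of_continuousOn (hif e) (hHc n e)).const_mul lam))
        ((hiv e).add ((hif e).const_mul lam)).pos_part fun x => ?_
      have := hle n (v e x - v' e x + lam * (f e x - f' e x)) (u.toFun e x - u'.toFun e x)
      simp only
      linarith
    rw [mul_add, Finset.mul_sum, Finset.mul_sum] at h0
    linarith
  suffices hlim : ∀ e, Filter.Tendsto
      (fun n => ∫ x, (v e x - v' e x) * H n (u.toFun e x - u'.toFun e x) ∂G.edgeMeasure e)
      Filter.atTop (𝓝 (∫ x, max (v e x - v' e x) 0 ∂G.edgeMeasure e)) by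
    exact le_of_tendsto' (tendsto_finsetSum _ fun e _ => hlim e) hbound
  intro e
  refine tendsto_integral_of_dominated_convergence (fun x => |v e x - v' e x|)
    (fun n => (integrable_mul_of_continuousOn (hiv e) (hHc n e)).1) (hiv e).abs
    (fun n => Filter.Eventually.of_forall fun x => ?_) ?_
  · rw [Real.norm_eq_abs, abs_mul, abs_of_nonneg (hH0 _ _)]
    exact mul_le_of_le_one_right (abs_nonneg _) (hH1 _ _)
  · filter_upwards [hv e, hv' e] with x hx hx'
    rcases le_or_gt (u.toFun e x) (u'.toFun e x) with hu | hu
    · have h1 : v e x - v' e x ≤ 0 := by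
        rw [hx, hx']; exact sub_nonpos.2 ((hγ e).monotone hu)
      rw [max_eq_right h1]
      have h2 : ∀ n : ℕ, H n (u.toFun e x - u'.toFun e x) = 0 := fun n =>
        Real.smoothTransition.zero_of_nonpos
          (mul_nonpos_of_nonneg_of_nonpos n.cast_nonneg (sub_nonpos.2 hu))
      simp [h2]
    · have h1 : 0 ≤ v e x - v' e x := by
        rw [hx, hx']; exact sub_nonneg.2 ((hγ e).monotone hu.le)
      rw [max_eq_left h1]
      refine tendsto_const_nhds.congr' ?_
      have hpos := sub_pos.2 hu
      obtain ⟨N, hN⟩ := exists_nat_ge (u.toFun e x - u'.toFun e x)⁻¹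
      filter_upwards [Filter.eventually_ge_atTop N] with n hn
      have h2 : H n (u.toFun e x - u'.toFun e x) = 1 := by
        refine Real.smoothTransition.one_of_one_le ?_
        have h3 : (u.toFun e x - u'.toFun e x)⁻¹ ≤ n := hN.trans (by exact_mod_cast hn)
        exact (inv_le_iff_one_le_mul₀ hpos).1 h3
      rw [h2, mul_one]

/-- The norm of the positive part of an element of `X`. -/
theorem norm_posPart_toLp (g : G.L1) (w : PiLp 1 fun _ : V => ℝ) :
    ‖(WithLp.toLp 1 (g, w) : G.X)⁺‖ =
      (∑ e, ∫ x, max (g e x) 0 ∂G.edgeMeasure e) + ∑ a, max (w a) 0 := by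
  rw [posPart_def, WithLp.prod_norm_eq_of_L1, PiLp.norm_eq_of_L1, PiLp.norm_eq_of_L1]
  congr 1
  · exact Finset.sum_congr rfl fun e _ => norm_L1_posPart_apply e (g e)
  · exact Finset.sum_congr rfl fun a _ => abs_of_nonneg (le_max_right (w a) 0)

theorem norm_eq_norm_posPart_add (z : G.X) : ‖z‖ = ‖z⁺‖ + ‖(-z)⁺‖ := by
  obtain ⟨g, w⟩ := z
  have hneg : -(WithLp.toLp 1 (g, w) : G.X) = WithLp.toLp 1 (-g, -w) := rfl
  rw [hneg, norm_posPart_toLp, norm_posPart_toLp, WithLp.prod_norm_eq_of_L1, PiLp.norm_eq_of_L1,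
    PiLp.norm_eq_of_L1, add_add_add_comm, ← Finset.sum_add_distrib, ← Finset.sum_add_distrib]
  have hmax : ∀ r : ℝ, |r| = max r 0 + max (-r) 0 := fun r => by
    rcases le_total 0 r with h | h
    · rw [abs_of_nonneg h, max_eq_left h, max_eq_right (by linarith), add_zero]
    · rw [abs_of_nonpos h, max_eq_right h, max_eq_left (by linarith), zero_add]
  congr 1
  · refine Finset.sum_congr rfl fun e _ => ?_
    rw [← integral_add (g.integrable e).pos_part ((-g).integrable e).pos_part]
    change ‖g e‖ = _
    rw [L1.norm_eq_integral_norm]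
    refine integral_congr_ae ?_
    filter_upwards [Lp.coeFn_neg (g e)] with x hx
    have : (-g) e x = -g e x := hx
    rw [this, Real.norm_eq_abs, hmax]
  · exact Finset.sum_congr rfl fun a _ => hmax (w a)

theorem isTAccretive_opA (hp : ∀ e, 1 < p e) {γ : E → ℝ → ℝ} (hγ : ∀ e, StrictMono (γ e)) :
    NonlinearOperator.IsTAccretive (G.opA p γ) := by
  rintro _ ⟨v, f, w, rfl, hs⟩ _ ⟨v', f', w', rfl, hs'⟩ lam hlam
  obtain ⟨u, hu, h⟩ := isWeakSolution_add_iff.1 hs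
  obtain ⟨u', hu', h'⟩ := isWeakSolution_add_iff.1 hs'
  have key := h.sum_integral_posPart_le hp hγ hu hu' h' hlam.le
  change ‖(WithLp.toLp 1 (v - v', (0 : PiLp 1 fun _ : V => ℝ) - 0) : G.X)⁺‖ ≤
    ‖(WithLp.toLp 1 (v - v' + lam • (f - f'),
      (0 : PiLp 1 fun _ : V => ℝ) - 0 + lam • (w - w')) : G.X)⁺‖
  rw [norm_posPart_toLp, norm_posPart_toLp]
  refine le_of_eq_of_le ?_ (key.trans_eq ?_)
  · simp only [sub_zero, PiLp.zero_apply, max_self, Finset.sum_const_zero, add_zero]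
    refine Finset.sum_congr rfl fun e _ => integral_congr_ae ?_
    filter_upwards [Lp.coeFn_sub (v e) (v' e)] with x hx
    have : (v - v') e x = v e x - v' e x := hx
    rw [this]
  · congr 1
    · refine Finset.sum_congr rfl fun e _ => integral_congr_ae ?_
      filter_upwards [Lp.coeFn_sub (v e) (v' e), Lp.coeFn_sub (f e) (f' e),
        Lp.coeFn_smul lam (f e - f' e), Lp.coeFn_add (v e - v' e) (lam • (f e - f' e))]
        with x h1 h2 h3 h4
      have : (v - v' + lam • (f - f')) e x = v e x - v' e x + lam * (f e x - f' e x) := by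
        refine h4.trans ?_
        rw [Pi.add_apply, h1, h3, Pi.smul_apply, h2]
        rfl
      rw [this]
    · refine Finset.sum_congr rfl fun a _ => ?_
      simp

/-- In a space whose norm is additive on the positive cone, T-accretivity implies accretivity. -/
theorem isAccretive_opA (hp : ∀ e, 1 < p e) {γ : E → ℝ → ℝ} (hγ : ∀ e, StrictMono (γ e)) :
    NonlinearOperator.IsAccretive (G.opA p γ) := by
  intro z hz z' hz' lam hlam
  rcases hlam.eq_or_lt with rfl | hlam
  · rw [zero_smul, add_zero]
  · have h1 := isTAccretive_opA hp hγ z hz z' hz' lam hlam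
    have h2 := isTAccretive_opA hp hγ z' hz' z hz lam hlam
    rw [norm_eq_norm_posPart_add (z.1 - z'.1),
      norm_eq_norm_posPart_add (z.1 - z'.1 + lam • (z.2 - z'.2))]
    have e1 : -(z.1 - z'.1) = z'.1 - z.1 := neg_sub _ _
    have e2 : -(z.1 - z'.1 + lam • (z.2 - z'.2)) = z'.1 - z.1 + lam • (z'.2 - z.2) := by
      rw [neg_add, neg_sub, ← smul_neg, neg_sub]
    rw [e1, e2]
    exact add_le_add h1 h2

end MetricGraph

/-! ### Primitives of a monotone nonlinearity -/

/-- The convex primitive `s ↦ ∫₀ˢ γ` of a nondecreasing function `γ`. -/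
noncomputable def convexPrimitive (γ : ℝ → ℝ) (s : ℝ) : ℝ := ∫ t in (0 : ℝ)..s, γ t

section convexPrimitive

variable {γ : ℝ → ℝ}

theorem continuous_convexPrimitive (hc : Continuous γ) : Continuous (convexPrimitive γ) :=
  intervalIntegral.continuous_primitive (fun a b => hc.intervalIntegrable a b) 0

theorem mul_sub_le_convexPrimitive (hc : Continuous γ) (hm : Monotone γ) (a b : ℝ) :
    γ a * (b - a) ≤ convexPrimitive γ b - convexPrimitive γ a := by
  have h : convexPrimitive γ b - convexPrimitive γ a = ∫ t in a..b, γ t :=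
    intervalIntegral.integral_interval_sub_left (hc.intervalIntegrable _ _)
      (hc.intervalIntegrable _ _)
  rw [h]
  rcases le_total a b with hab | hab
  · have := intervalIntegral.integral_mono_on (μ := volume) hab
      (intervalIntegrable_const (c := γ a)) (hc.intervalIntegrable a b) fun t ht => hm ht.1
    rw [intervalIntegral.integral_const, smul_eq_mul] at this
    linarith
  · have := intervalIntegral.integral_mono_on (μ := volume) hab (hc.intervalIntegrable b a)
      (intervalIntegrable_const (c := γ a)) fun t ht => hm ht.2
    rw [intervalIntegral.integral_const, smul_eq_mul] at this
    rw [intervalIntegral.integral_symm]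
    linarith

theorem convexPrimitive_midpoint_le (hc : Continuous γ) (hm : Monotone γ) (a b : ℝ) :
    convexPrimitive γ ((a + b) / 2) ≤ (convexPrimitive γ a + convexPrimitive γ b) / 2 := by
  have h1 := mul_sub_le_convexPrimitive hc hm ((a + b) / 2) a
  have h2 := mul_sub_le_convexPrimitive hc hm ((a + b) / 2) b
  linarith

/-- The primitive of a nondecreasing function that maps onto `ℝ` grows faster than any linear
function: compare with the tangents of slopes `A` and `-A`. -/
theorem exists_mul_abs_sub_le_convexPrimitive (hc : Continuous γ) (hm : Monotone γ)
    (hs : Function.Surjective γ) (A : ℝ) : ∃ B, ∀ s, A * |s| - B ≤ convexPrimitive γ s := by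
  obtain ⟨t₁, h₁⟩ := hs A
  obtain ⟨t₂, h₂⟩ := hs (-A)
  refine ⟨max (A * t₁ - convexPrimitive γ t₁) (-A * t₂ - convexPrimitive γ t₂), fun s => ?_⟩
  have e1 := mul_sub_le_convexPrimitive hc hm t₁ s
  have e2 := mul_sub_le_convexPrimitive hc hm t₂ s
  rw [h₁] at e1
  rw [h₂] at e2
  have m1 := le_max_left (A * t₁ - convexPrimitive γ t₁) (-A * t₂ - convexPrimitive γ t₂)
  have m2 := le_max_right (A * t₁ - convexPrimitive γ t₁) (-A * t₂ - convexPrimitive γ t₂)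
  rcases le_total 0 s with h | h
  · rw [abs_of_nonneg h]; linarith
  · rw [abs_of_nonpos h]; linarith

end convexPrimitive

/-! ### Convergence in the mean of order `p` -/

theorem exists_mul_abs_le_rpow {p : ℝ} (hp : 1 < p) {K : ℝ} (hK : 0 ≤ K) :
    ∃ C, ∀ s : ℝ, K * |s| ≤ |s| ^ p / (2 * p) + C := by
  -- the tangent of slope `2 K`
  let a : ℝ := (2 * K) ^ (p - 1)⁻¹
  have ha : 0 ≤ a := by positivity
  have hf : pFlux p a = 2 * K := by
    have h1 : |pFlux p a| = 2 * K := by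
      rw [abs_pFlux hp, abs_of_nonneg ha, ← Real.rpow_mul (by positivity),
        inv_mul_cancel₀ (by linarith), Real.rpow_one]
    rwa [abs_of_nonneg (by unfold pFlux; positivity)] at h1
  refine ⟨K * a, fun s => ?_⟩
  have h := pFlux_mul_sub_le hp a |s|
  rw [hf, abs_abs] at h
  have h2 : 0 ≤ |a| ^ p / p := by positivity
  have h3 : |s| ^ p / (2 * p) = |s| ^ p / p / 2 := by field_simp
  rw [h3]
  linarith

theorem abs_le_add_rpow {p : ℝ} (hp : 1 < p) {ε : ℝ} (hε : 0 < ε) (s : ℝ) :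
    |s| ≤ ε + ε ^ (1 - p) * |s| ^ p := by
  rcases le_or_gt |s| ε with h | h
  · have : 0 ≤ ε ^ (1 - p) * |s| ^ p := by positivity
    linarith
  · have hs : 0 < |s| := hε.trans h
    have h1 : |s| ^ (1 - p) * |s| ^ p = |s| := by
      rw [← Real.rpow_add hs]; simp
    have h2 : |s| ^ (1 - p) ≤ ε ^ (1 - p) :=
      Real.rpow_le_rpow_of_nonpos hε h.le (by linarith)
    have h3 : |s| ^ (1 - p) * |s| ^ p ≤ ε ^ (1 - p) * |s| ^ p := by gcongr
    linarith

section Lp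

variable {α : Type*} [MeasurableSpace α] {μ : Measure α} {p : ℝ}

theorem integral_abs_rpow_eq_norm_toLp (hp : 1 < p) {f : α → ℝ}
    (hf : MemLp f (ENNReal.ofReal p) μ) :
    ∫ x, |f x| ^ p ∂μ = ‖hf.toLp f‖ ^ p := by
  have hp0 : 0 < p := by linarith
  rw [Lp.norm_toLp, hf.eLpNorm_eq_integral_rpow_norm (by simpa using hp0) (by simp),
    ENNReal.toReal_ofReal hp0.le, ENNReal.toReal_ofReal (by positivity),
    ← Real.rpow_mul (integral_nonneg fun x => by positivity), inv_mul_cancel₀ hp0.ne',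
    Real.rpow_one]
  rfl

/-- Completeness of `Lᵖ`, in terms of integrals of `p`-th powers. -/
theorem exists_memLp_tendsto_of_cauchy (hp : 1 < p) {f : ℕ → α → ℝ}
    (hf : ∀ n, MemLp (f n) (ENNReal.ofReal p) μ)
    (hc : ∀ ε > 0, ∃ N, ∀ n ≥ N, ∀ m ≥ N, ∫ x, |f n x - f m x| ^ p ∂μ < ε) :
    ∃ g : α → ℝ, MemLp g (ENNReal.ofReal p) μ ∧
      Filter.Tendsto (fun n => ∫ x, |f n x - g x| ^ p ∂μ) Filter.atTop (𝓝 0) ∧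
      Filter.Tendsto (fun n => ∫ x, |f n x| ^ p ∂μ) Filter.atTop (𝓝 (∫ x, |g x| ^ p ∂μ)) := by
  have hp0 : 0 < p := by linarith
  have : Fact (1 ≤ ENNReal.ofReal p) :=
    ⟨by rw [← ENNReal.ofReal_one]; exact ENNReal.ofReal_le_ofReal hp.le⟩
  let F : ℕ → Lp ℝ (ENNReal.ofReal p) μ := fun n => (hf n).toLp (f n)
  have hF : CauchySeq F := by
    rw [Metric.cauchySeq_iff]
    intro ε hε
    obtain ⟨N, hN⟩ := hc (ε ^ p) (by positivity)
    refine ⟨N, fun n hn m hm => ?_⟩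
    have h1 := hN n hn m hm
    have h2 := integral_abs_rpow_eq_norm_toLp hp ((hf n).sub (hf m))
    simp only [Pi.sub_apply] at h2
    rw [h2, MemLp.toLp_sub (hf n) (hf m)] at h1
    rw [dist_eq_norm]
    exact (Real.rpow_lt_rpow_iff (norm_nonneg _) hε.le hp0).1 h1
  obtain ⟨g, hg⟩ := cauchySeq_tendsto_of_complete hF
  refine ⟨g, Lp.memLp g, ?_, ?_⟩
  · have h1 : ∀ n, ∫ x, |f n x - g x| ^ p ∂μ = ‖F n - g‖ ^ p := fun n => by
      have h2 := integral_abs_rpow_eq_norm_toLp hp ((hf n).sub (Lp.memLp g))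
      rw [MemLp.toLp_sub (hf n) (Lp.memLp g), Lp.toLp_coeFn] at h2
      exact h2
    simp only [h1]
    have h3 : Filter.Tendsto (fun n => ‖F n - g‖) Filter.atTop (𝓝 0) :=
      tendsto_iff_norm_sub_tendsto_zero.1 hg
    simpa [Real.zero_rpow hp0.ne'] using h3.rpow_const (Or.inr hp0.le)
  · have h1 : ∫ x, |g x| ^ p ∂μ = ‖g‖ ^ p := by
      have h2 := integral_abs_rpow_eq_norm_toLp hp (Lp.memLp g)
      rwa [Lp.toLp_coeFn] at h2
    have h3 : ∀ n, ∫ x, |f n x| ^ p ∂μ = ‖F n‖ ^ p := fun n =>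
      integral_abs_rpow_eq_norm_toLp hp (hf n)
    simp only [h1, h3]
    exact hg.norm.rpow_const (Or.inr hp0.le)

theorem tendsto_integral_abs_of_tendsto_rpow [IsFiniteMeasure μ] (hp : 1 < p) {f : ℕ → α → ℝ}
    (hf : ∀ n, MemLp (f n) (ENNReal.ofReal p) μ)
    (h : Filter.Tendsto (fun n => ∫ x, |f n x| ^ p ∂μ) Filter.atTop (𝓝 0)) :
    Filter.Tendsto (fun n => ∫ x, |f n x| ∂μ) Filter.atTop (𝓝 0) := by
  have hp0 : 0 < p := by linarith
  have h1p : 1 ≤ ENNReal.ofReal p := by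
    rw [← ENNReal.ofReal_one]; exact ENNReal.ofReal_le_ofReal hp.le
  have hI : ∀ n, Integrable (fun x => |f n x| ^ p) μ := fun n => by
    have := (hf n).integrable_norm_rpow (by simpa using hp0) (by simp)
    rwa [ENNReal.toReal_ofReal hp0.le] at this
  rw [Metric.tendsto_atTop] at h ⊢
  intro ε hε
  have hm : 0 ≤ μ.real univ := measureReal_nonneg
  let δ : ℝ := ε / (2 * (μ.real univ + 1))
  have hδ : 0 < δ := by positivity
  have hδε : δ * μ.real univ < ε / 2 := by
    have h1 : δ * (μ.real univ + 1) = ε / 2 := by simp only [δ]; field_simp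
    nlinarith
  have hδp : 0 < δ ^ (1 - p) := Real.rpow_pos_of_pos hδ _
  obtain ⟨N, hN⟩ := h (ε / 2 / δ ^ (1 - p)) (by positivity)
  refine ⟨N, fun n hn => ?_⟩
  have h1 := hN n hn
  rw [Real.dist_0_eq_abs, abs_of_nonneg (integral_nonneg fun x => by positivity),
    lt_div_iff₀ hδp] at h1
  rw [Real.dist_0_eq_abs, abs_of_nonneg (integral_nonneg fun x => abs_nonneg _)]
  have h2 : ∫ x, |f n x| ∂μ ≤ ∫ x, (δ + δ ^ (1 - p) * |f n x| ^ p) ∂μ :=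
    integral_mono ((hf n).integrable h1p).abs ((integrable_const _).add ((hI n).const_mul _))
      fun x => abs_le_add_rpow hp hδ _
  rw [integral_add (integrable_const _) ((hI n).const_mul _), integral_const, integral_const_mul,
    smul_eq_mul] at h2
  linarith

end Lp

/-! ### The energy functional and its minimizers -/

namespace MetricGraph

variable {V E : Type*} {G : MetricGraph V E} {p : E → ℝ}

/-- Every vertex of a metric graph with at least one edge is an end point of some edge. -/
theorem exists_edge_of_vertex [Nonempty E] (G : MetricGraph V E) (a : V) :
    ∃ e, G.src e = a ∨ G.tgt e = a := by
  obtain ⟨e₀⟩ := ‹Nonempty E›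
  have : Nontrivial V := ⟨⟨G.src e₀, G.tgt e₀, G.loopless e₀⟩⟩
  obtain ⟨b, hb⟩ := G.connected.preconnected.exists_adj_of_nontrivial a
  rw [SimpleGraph.fromRel_adj] at hb
  rcases hb.2 with ⟨e, h1, _⟩ | ⟨e, _, h2⟩
  · exact ⟨e, Or.inl h1⟩
  · exact ⟨e, Or.inr h2⟩

theorem sum_vertices_le_sum_edges [Fintype V] [Fintype E] [Nonempty E] (G : MetricGraph V E)
    {c : V → ℝ} (hc : ∀ a, 0 ≤ c a) : ∑ a, c a ≤ ∑ e, (c (G.src e) + c (G.tgt e)) := by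
  classical
  have h1 : ∀ e, c (G.src e) + c (G.tgt e) =
      ∑ a, ((if G.src e = a then c a else 0) + if G.tgt e = a then c a else 0) := fun e => by
    rw [Finset.sum_add_distrib]
    simp
  simp only [h1]
  rw [Finset.sum_comm]
  refine Finset.sum_le_sum fun a _ => ?_
  have hn : ∀ e, 0 ≤ (if G.src e = a then c a else 0) + if G.tgt e = a then c a else 0 :=
    fun e => add_nonneg (by split_ifs <;> simp [hc a]) (by split_ifs <;> simp [hc a])
  obtain ⟨e, he⟩ := G.exists_edge_of_vertex a
  refine le_trans ?_ (Finset.single_le_sum (fun e _ => hn e) (Finset.mem_univ e))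
  rcases he with h | h
  · rw [if_pos h]
    exact le_add_of_nonneg_right (by split_ifs <;> simp [hc a])
  · rw [if_pos h]
    exact le_add_of_nonneg_left (by split_ifs <;> simp [hc a])

/-- The contribution of the edge `e` to the energy. -/
noncomputable def edgeEnergy (γ g : ℝ → ℝ) (u : G.W1 p) (e : E) : ℝ :=
  (∫ x, |u.deriv e x| ^ p e ∂G.edgeMeasure e) / p e +
    (∫ x, convexPrimitive γ (u.toFun e x) ∂G.edgeMeasure e) -
    ∫ x, g x * u.toFun e x ∂G.edgeMeasure e

/-- The energy whose Euler-Lagrange equation is the weak form of `-Δ_p u + γ(u) = g` on the edges,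
with flux `η` at the vertices. -/
noncomputable def energy [Fintype V] [Fintype E] (γ g : E → ℝ → ℝ) (η : V → ℝ) (u : G.W1 p) : ℝ :=
  (∑ e, edgeEnergy (γ e) (g e) u e) - ∑ a, η a * u.vertexValue a

theorem W1.abs_sub_src_le (hp : ∀ e, 1 < p e) (u : G.W1 p) (e : E) {x : ℝ}
    (hx : x ∈ Icc 0 (G.length e)) :
    |u.toFun e x - u.vertexValue (G.src e)| ≤ ∫ t, |u.deriv e t| ∂G.edgeMeasure e := by
  rw [← u.value_src]
  exact (u.isPrimitiveOn hp e).abs_sub_le hx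

theorem W1.integrable_comp (u : G.W1 p) (e : E) {F : ℝ → ℝ} (hF : Continuous F) :
    Integrable (fun x => F (u.toFun e x)) (G.edgeMeasure e) :=
  memLp_one_iff_integrable.1 ((hF.comp_continuousOn (u.continuousOn e)).memLp_Ioo 1)

theorem W1.integrable_deriv (hp : ∀ e, 1 < p e) (u : G.W1 p) (e : E) :
    Integrable (u.deriv e) (G.edgeMeasure e) :=
  (u.memLp_deriv e).integrable (one_le_ofReal_exponent hp e)

theorem ae_mem_Icc (e : E) : ∀ᵐ x ∂G.edgeMeasure e, x ∈ Icc 0 (G.length e) := by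
  rw [ae_restrict_iff' measurableSet_Ioo]
  exact Filter.Eventually.of_forall fun x hx => Ioo_subset_Icc_self hx

theorem integral_const_edge (e : E) (c : ℝ) : ∫ _, c ∂G.edgeMeasure e = G.length e * c := by
  rw [integral_const, measureReal_restrict_apply_univ, Real.volume_real_Ioo_of_le
    (G.length_pos e).le, sub_zero, smul_eq_mul]

/-- Coercivity of the energy on one edge: it dominates any given multiple of the end point values.
The superlinear growth of the primitive of `γ` controls the values of `u`, and the power
`|u'|^p` controls its oscillation. -/
theorem exists_le_edgeEnergy (hp : ∀ e, 1 < p e) (e : E) {γ g : ℝ → ℝ} (hc : Continuous γ)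
    (hm : Monotone γ) (hs : Function.Surjective γ) (hg : Integrable g (G.edgeMeasure e))
    {M : ℝ} (hM : 0 ≤ M) :
    ∃ C, ∀ u : G.W1 p, M * (|u.vertexValue (G.src e)| + |u.vertexValue (G.tgt e)|) +
      (∫ x, |u.deriv e x| ^ p e ∂G.edgeMeasure e) / (2 * p e) - C ≤ edgeEnergy γ g u e := by
  set ℓ := G.length e with hℓ
  have hℓ0 : 0 < ℓ := G.length_pos e
  set N : ℝ := ∫ x, |g x| ∂G.edgeMeasure e
  have hN : 0 ≤ N := integral_nonneg fun x => abs_nonneg _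
  -- slope of a linear lower bound for the primitive of `γ`, large enough to absorb the source term
  -- and to leave the factor `M` in front of the end point values
  let A : ℝ := 2 * (N + M) / ℓ
  have hA : 0 ≤ A := by positivity
  have hAℓ : ℓ * A = 2 * (N + M) := by simp only [A]; field_simp
  obtain ⟨B, hB⟩ := exists_mul_abs_sub_le_convexPrimitive hc hm hs A
  -- half of the term `|u'|^p / p` absorbs all multiples of the oscillation of `u`
  obtain ⟨C, hC⟩ := exists_mul_abs_le_rpow (hp e) (K := 3 / 2 * (ℓ * A) + N) (by positivity)
  refine ⟨ℓ * C + ℓ * B, fun u => ?_⟩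
  set a := u.vertexValue (G.src e)
  set b := u.vertexValue (G.tgt e)
  set I : ℝ := ∫ t, |u.deriv e t| ∂G.edgeMeasure e
  have hosc : ∀ x ∈ Icc 0 ℓ, |u.toFun e x - a| ≤ I := fun x hx => u.abs_sub_src_le hp e hx
  have hb : |b - a| ≤ I := by
    have := hosc ℓ (right_mem_Icc.2 hℓ0.le)
    rwa [hℓ, u.value_tgt] at this
  have hI : (3 / 2 * (ℓ * A) + N) * I ≤
      (∫ x, |u.deriv e x| ^ p e ∂G.edgeMeasure e) / (2 * p e) + ℓ * C := by
    have h1 : ∫ x, (3 / 2 * (ℓ * A) + N) * |u.deriv e x| ∂G.edgeMeasure e ≤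
        ∫ x, (|u.deriv e x| ^ p e / (2 * p e) + C) ∂G.edgeMeasure e :=
      integral_mono ((u.integrable_deriv hp e).abs.const_mul _)
        (((integrable_abs_rpow hp (u.memLp_deriv e)).div_const _).add (integrable_const _))
        fun x => hC _
    rwa [integral_const_mul, integral_add
      ((integrable_abs_rpow hp (u.memLp_deriv e)).div_const _) (integrable_const _),
      integral_div, integral_const_edge] at h1
  have hΓ : ℓ * (A * ((|a| + |b|) / 2 - 3 / 2 * I) - B) ≤
      ∫ x, convexPrimitive γ (u.toFun e x) ∂G.edgeMeasure e := by
    rw [← integral_const_edge]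
    refine integral_mono_ae (integrable_const _)
      (u.integrable_comp e (continuous_convexPrimitive hc)) ?_
    filter_upwards [ae_mem_Icc e] with x hx
    have h1 : |a| ≤ |u.toFun e x| + I := by
      have := abs_sub_abs_le_abs_sub a (u.toFun e x)
      rw [abs_sub_comm] at this
      linarith [hosc x hx]
    have h2 : |b| ≤ |a| + I := by linarith [abs_sub_abs_le_abs_sub b a]
    have h3 : (|a| + |b|) / 2 - 3 / 2 * I ≤ |u.toFun e x| := by linarith
    have h4 := mul_le_mul_of_nonneg_left h3 hA
    linarith [hB (u.toFun e x)]
  have hgu : ∫ x, g x * u.toFun e x ∂G.edgeMeasure e ≤ N * (|a| + I) := by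
    rw [← integral_mul_const]
    refine integral_mono_ae (integrable_mul_of_continuousOn hg (u.continuousOn e))
      (hg.abs.mul_const _) ?_
    filter_upwards [ae_mem_Icc e] with x hx
    have h1 : |u.toFun e x| ≤ |a| + I := by
      linarith [abs_sub_abs_le_abs_sub (u.toFun e x) a, hosc x hx]
    calc g x * u.toFun e x ≤ |g x| * |u.toFun e x| := by rw [← abs_mul]; exact le_abs_self _
      _ ≤ |g x| * (|a| + I) := by gcongr
  have hD : (∫ x, |u.deriv e x| ^ p e ∂G.edgeMeasure e) / p e =
      2 * ((∫ x, |u.deriv e x| ^ p e ∂G.edgeMeasure e) / (2 * p e)) := by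
    field_simp
  have hNb : 0 ≤ N * |b| := by positivity
  unfold edgeEnergy
  rw [hD]
  have e1 : ℓ * (A * ((|a| + |b|) / 2 - 3 / 2 * I) - B) =
      (N + M) * (|a| + |b|) - 3 / 2 * (ℓ * A) * I - ℓ * B := by
    linear_combination ((|a| + |b|) / 2) * hAℓ
  rw [e1] at hΓ
  nlinarith

/-- Uniform convexity of the energy on one edge. -/
theorem edgeEnergy_midpoint_le (hp : ∀ e, 1 < p e) (e : E) {γ g : ℝ → ℝ} (hc : Continuous γ)
    (hm : Monotone γ) (hg : Integrable g (G.edgeMeasure e)) {u v w : G.W1 p}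
    (hw : ∀ x, w.toFun e x = (u.toFun e x + v.toFun e x) / 2)
    (hw' : ∀ x, w.deriv e x = (u.deriv e x + v.deriv e x) / 2) :
    edgeEnergy γ g w e + (∫ x, ((|u.deriv e x| ^ p e + |v.deriv e x| ^ p e) / 2 -
      |(u.deriv e x + v.deriv e x) / 2| ^ p e) ∂G.edgeMeasure e) / p e ≤
      (edgeEnergy γ g u e + edgeEnergy γ g v e) / 2 := by
  have iu := integrable_abs_rpow hp (u.memLp_deriv e)
  have iv := integrable_abs_rpow hp (v.memLp_deriv e)
  have iw := integrable_abs_rpow hp (w.memLp_deriv e)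
  have e1 : ∫ x, ((|u.deriv e x| ^ p e + |v.deriv e x| ^ p e) / 2 -
      |(u.deriv e x + v.deriv e x) / 2| ^ p e) ∂G.edgeMeasure e =
      ((∫ x, |u.deriv e x| ^ p e ∂G.edgeMeasure e) +
        ∫ x, |v.deriv e x| ^ p e ∂G.edgeMeasure e) / 2 -
        ∫ x, |w.deriv e x| ^ p e ∂G.edgeMeasure e := by
    simp only [← hw']
    have iuv : Integrable (fun x => (|u.deriv e x| ^ p e + |v.deriv e x| ^ p e) / 2)
        (G.edgeMeasure e) := (iu.add iv).div_const 2
    rw [integral_sub iuv iw, integral_div, integral_add iu iv]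
  have iΓ : ∀ z : G.W1 p, Integrable (fun x => convexPrimitive γ (z.toFun e x))
      (G.edgeMeasure e) := fun z => z.integrable_comp e (continuous_convexPrimitive hc)
  have e2 : ∫ x, convexPrimitive γ (w.toFun e x) ∂G.edgeMeasure e ≤
      ((∫ x, convexPrimitive γ (u.toFun e x) ∂G.edgeMeasure e) +
        ∫ x, convexPrimitive γ (v.toFun e x) ∂G.edgeMeasure e) / 2 := by
    rw [← integral_add (iΓ u) (iΓ v), ← integral_div]
    refine integral_mono (iΓ w) (((iΓ u).add (iΓ v)).div_const 2) fun x => ?_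
    simp only [hw]
    exact convexPrimitive_midpoint_le hc hm _ _
  have e3 : ∫ x, g x * w.toFun e x ∂G.edgeMeasure e =
      ((∫ x, g x * u.toFun e x ∂G.edgeMeasure e) +
        ∫ x, g x * v.toFun e x ∂G.edgeMeasure e) / 2 := by
    rw [← integral_add (integrable_mul_of_continuousOn hg (u.continuousOn e))
      (integrable_mul_of_continuousOn hg (v.continuousOn e)), ← integral_div]
    congr 1
    ext x
    rw [hw]
    ring
  unfold edgeEnergy
  have e4 : ∀ X Y Z : ℝ, ((X + Y) / 2 - Z) / p e = (X / p e + Y / p e) / 2 - Z / p e :=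
    fun X Y Z => by ring
  rw [e1, e3, e4]
  linarith

/-- The integral over an edge of a continuous function of `u` depends continuously on `u`, for
uniform convergence. -/
theorem tendsto_edge_integrals {e : E} {F g : ℝ → ℝ} (hF : Continuous F)
    (hg : Integrable g (G.edgeMeasure e)) {u : ℕ → G.W1 p} {w : G.W1 p} {δ : ℕ → ℝ}
    (hδ : Filter.Tendsto δ Filter.atTop (𝓝 0))
    (h : ∀ n, ∀ x ∈ Icc 0 (G.length e), |(u n).toFun e x - w.toFun e x| ≤ δ n) :
    Filter.Tendsto (fun n => ∫ x, F ((u n).toFun e x) ∂G.edgeMeasure e) Filter.atTop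
      (𝓝 (∫ x, F (w.toFun e x) ∂G.edgeMeasure e)) ∧
    Filter.Tendsto (fun n => ∫ x, g x * (u n).toFun e x ∂G.edgeMeasure e) Filter.atTop
      (𝓝 (∫ x, g x * w.toFun e x ∂G.edgeMeasure e)) := by
  obtain ⟨R, hR⟩ := isCompact_Icc.exists_bound_of_continuousOn (w.continuousOn e)
  obtain ⟨D, hD⟩ := (Metric.isBounded_range_of_tendsto δ hδ).exists_norm_le
  have hbd : ∀ n, ∀ x ∈ Icc 0 (G.length e), |(u n).toFun e x| ≤ R + D := fun n x hx => by
    have h1 := hR x hx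
    have h2 := (le_abs_self _).trans (hD (δ n) (mem_range_self n))
    rw [Real.norm_eq_abs] at h1
    linarith [abs_sub_abs_le_abs_sub ((u n).toFun e x) (w.toFun e x), h n x hx]
  have hlim : ∀ x ∈ Icc 0 (G.length e),
      Filter.Tendsto (fun n => (u n).toFun e x) Filter.atTop (𝓝 (w.toFun e x)) := fun x hx => by
    rw [tendsto_iff_norm_sub_tendsto_zero]
    exact squeeze_zero (fun n => norm_nonneg _) (fun n => h n x hx) hδ
  constructor
  · obtain ⟨K, hK⟩ := (isCompact_Icc (a := -(R + D)) (b := R + D)).exists_bound_of_continuousOn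
      hF.continuousOn
    refine tendsto_integral_of_dominated_convergence (fun _ => K)
      (fun n => ((u n).integrable_comp e hF).1) (integrable_const _) (fun n => ?_) ?_
    · filter_upwards [ae_mem_Icc e] with x hx using hK _ (abs_le.1 (hbd n x hx))
    · filter_upwards [ae_mem_Icc e] with x hx using (hF.tendsto _).comp (hlim x hx)
  · refine tendsto_integral_of_dominated_convergence (fun x => |g x| * (R + D))
      (fun n => (integrable_mul_of_continuousOn hg ((u n).continuousOn e)).1)
      (hg.abs.mul_const _) (fun n => ?_) ?_
    · filter_upwards [ae_mem_Icc e] with x hx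
      rw [Real.norm_eq_abs, abs_mul]
      exact mul_le_mul_of_nonneg_left (hbd n x hx) (abs_nonneg _)
    · filter_upwards [ae_mem_Icc e] with x hx using (hlim x hx).const_mul _

end MetricGraph

namespace MetricGraph

variable {V E : Type*} [Fintype V] [Fintype E] {G : MetricGraph V E} {p : E → ℝ}

section Minimizer

variable {γ g : E → ℝ → ℝ} {η : V → ℝ}

theorem exists_le_energy [Nonempty E] (hp : ∀ e, 1 < p e) (hc : ∀ e, Continuous (γ e))
    (hm : ∀ e, Monotone (γ e)) (hs : ∀ e, Function.Surjective (γ e))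
    (hg : ∀ e, Integrable (g e) (G.edgeMeasure e)) :
    ∃ C, ∀ u : G.W1 p, (∑ a, |u.vertexValue a|) +
      (∑ e, (∫ x, |u.deriv e x| ^ p e ∂G.edgeMeasure e) / (2 * p e)) - C ≤ energy γ g η u := by
  set S : ℝ := ∑ a, |η a|
  have hS : 0 ≤ S := Finset.sum_nonneg fun a _ => abs_nonneg _
  choose C hC using fun e => exists_le_edgeEnergy hp e (hc e) (hm e) (hs e) (hg e)
    (M := 1 + S) (by positivity)
  refine ⟨∑ e, C e, fun u => ?_⟩
  have h1 := Finset.sum_le_sum fun e (_ : e ∈ Finset.univ) => hC e u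
  rw [Finset.sum_sub_distrib, Finset.sum_add_distrib, ← Finset.mul_sum] at h1
  have h2 := mul_le_mul_of_nonneg_left
    (G.sum_vertices_le_sum_edges (c := fun a => |u.vertexValue a|) fun a => abs_nonneg _)
    (by positivity : 0 ≤ 1 + S)
  have h3 : ∑ a, η a * u.vertexValue a ≤ S * ∑ a, |u.vertexValue a| := by
    rw [Finset.mul_sum]
    refine Finset.sum_le_sum fun a _ => ?_
    calc η a * u.vertexValue a ≤ |η a| * |u.vertexValue a| := by
          rw [← abs_mul]; exact le_abs_self _
      _ ≤ S * |u.vertexValue a| := mul_le_mul_of_nonneg_right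
          (Finset.single_le_sum (f := fun a => |η a|) (fun a _ => abs_nonneg _)
            (Finset.mem_univ a)) (abs_nonneg _)
  unfold energy
  linarith

theorem exists_energy_midpoint_le (hp : ∀ e, 1 < p e) (hc : ∀ e, Continuous (γ e))
    (hm : ∀ e, Monotone (γ e)) (hg : ∀ e, Integrable (g e) (G.edgeMeasure e)) (u v : G.W1 p) :
    ∃ w : G.W1 p, energy γ g η w +
      ∑ e, (∫ x, ((|u.deriv e x| ^ p e + |v.deriv e x| ^ p e) / 2 -
        |(u.deriv e x + v.deriv e x) / 2| ^ p e) ∂G.edgeMeasure e) / p e ≤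
      (energy γ g η u + energy γ g η v) / 2 := by
  let w : G.W1 p := (u.addMul hp (1 / 2) v).addMul hp (-1 / 2) u
  refine ⟨w, ?_⟩
  have h1 := Finset.sum_le_sum fun e (_ : e ∈ Finset.univ) =>
    edgeEnergy_midpoint_le hp e (hc e) (hm e) (hg e) (u := u) (v := v) (w := w)
      (fun x => by
        change u.toFun e x + 1 / 2 * v.toFun e x + -1 / 2 * u.toFun e x = _
        ring)
      (fun x => by
        change u.deriv e x + 1 / 2 * v.deriv e x + -1 / 2 * u.deriv e x = _
        ring)
  rw [Finset.sum_add_distrib, ← Finset.sum_div, Finset.sum_add_distrib] at h1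
  have h2 : ∑ a, η a * w.vertexValue a =
      (∑ a, η a * u.vertexValue a + ∑ a, η a * v.vertexValue a) / 2 := by
    rw [← Finset.sum_add_distrib, Finset.sum_div]
    refine Finset.sum_congr rfl fun a _ => ?_
    change η a * (u.vertexValue a + 1 / 2 * v.vertexValue a + -1 / 2 * u.vertexValue a) = _
    ring
  unfold energy
  rw [h2]
  linarith

/-- The derivatives of a minimizing sequence converge strongly: by uniform convexity, the distance
of two derivatives is controlled by the defect of the energy at the midpoint. -/
theorem exists_tendsto_deriv_of_minimizing (hp : ∀ e, 1 < p e) (hc : ∀ e, Continuous (γ e))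
    (hm : ∀ e, Monotone (γ e)) (hg : ∀ e, Integrable (g e) (G.edgeMeasure e)) {m R : ℝ}
    (hmin : ∀ u : G.W1 p, m ≤ energy γ g η u) {u : ℕ → G.W1 p}
    (hu : Filter.Tendsto (fun n => energy γ g η (u n)) Filter.atTop (𝓝 m)) (e : E)
    (hR : ∀ n, ∫ x, |(u n).deriv e x| ^ p e ∂G.edgeMeasure e ≤ R) :
    ∃ d : ℝ → ℝ, MemLp d (ENNReal.ofReal (p e)) (G.edgeMeasure e) ∧
      Filter.Tendsto (fun n => ∫ x, |(u n).deriv e x - d x| ^ p e ∂G.edgeMeasure e)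
        Filter.atTop (𝓝 0) ∧
      Filter.Tendsto (fun n => ∫ x, |(u n).deriv e x| ^ p e ∂G.edgeMeasure e)
        Filter.atTop (𝓝 (∫ x, |d x| ^ p e ∂G.edgeMeasure e)) := by
  have hp0 : ∀ e, 0 < p e := fun e => one_pos.trans (hp e)
  have hR0 : 0 ≤ R := (integral_nonneg fun x => by positivity).trans (hR 0)
  refine exists_memLp_tendsto_of_cauchy (hp e) (fun n => (u n).memLp_deriv e) fun ε hε => ?_
  let ε' : ℝ := ε / (4 * (R + 1))
  have hε' : 0 < ε' := by positivity
  have hε'R : ε' * (R + R) < ε / 2 + ε / 4 := by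
    have : ε' * (4 * (R + 1)) = ε := by simp only [ε']; field_simp
    nlinarith
  obtain ⟨C, hC0, hC⟩ := exists_abs_sub_rpow_le (hp e) hε'
  have hδ : 0 < ε / (4 * (p e * (C + 1))) := by have := hp0 e; positivity
  have hev := hu.eventually_lt_const (lt_add_of_pos_right m hδ)
  obtain ⟨N, hN⟩ := Filter.eventually_atTop.1 hev
  refine ⟨N, fun n hn k hk => ?_⟩
  let Df : E → ℝ := fun e => ∫ x, ((|(u n).deriv e x| ^ p e + |(u k).deriv e x| ^ p e) / 2 -
    |((u n).deriv e x + (u k).deriv e x) / 2| ^ p e) ∂G.edgeMeasure e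
  have hDf : ∀ e, 0 ≤ Df e := fun e => integral_nonneg fun x =>
    sub_nonneg.2 (abs_add_div_two_rpow_le (hp e) _ _)
  obtain ⟨w, hw⟩ := exists_energy_midpoint_le (η := η) hp hc hm hg (u n) (u k)
  have h1 : Df e / p e ≤ ∑ e, Df e / p e :=
    Finset.single_le_sum (f := fun e => Df e / p e) (fun e _ => div_nonneg (hDf e) (hp0 e).le)
      (Finset.mem_univ e)
  have h2 : Df e / p e < ε / (4 * (p e * (C + 1))) := by
    have := hmin w
    have := hN n hn
    have := hN k hk
    change energy γ g η w + ∑ e, Df e / p e ≤ _ at hw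
    linarith
  have h3 : C * Df e < ε / 4 := by
    have hpe := hp0 e
    rw [div_lt_iff₀ hpe] at h2
    have h4 : ε / (4 * (p e * (C + 1))) * p e = ε / 4 / (C + 1) := by field_simp
    rw [h4, lt_div_iff₀ (by positivity)] at h2
    nlinarith [hDf e]
  have iu := integrable_abs_rpow hp ((u n).memLp_deriv e)
  have ik := integrable_abs_rpow hp ((u k).memLp_deriv e)
  have im := integrable_abs_rpow hp
    (((u n).addMul hp (-1) (u k)).memLp_deriv e)
  have is := integrable_abs_rpow hp
    ((((u n).addMul hp 1 (u k)).memLp_deriv e).mul_const (1 / 2))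
  have im' : Integrable (fun x => |(u n).deriv e x - (u k).deriv e x| ^ p e)
      (G.edgeMeasure e) := by
    refine im.congr (Filter.Eventually.of_forall fun x => ?_)
    change |(u n).deriv e x + -1 * (u k).deriv e x| ^ p e = _
    rw [neg_one_mul, ← sub_eq_add_neg]
  have is' : Integrable (fun x => |((u n).deriv e x + (u k).deriv e x) / 2| ^ p e)
      (G.edgeMeasure e) := by
    refine is.congr (Filter.Eventually.of_forall fun x => ?_)
    change |((u n).deriv e x + 1 * (u k).deriv e x) * (1 / 2)| ^ p e = _
    rw [one_mul, mul_one_div]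
  have iD : Integrable (fun x => (|(u n).deriv e x| ^ p e + |(u k).deriv e x| ^ p e) / 2 -
      |((u n).deriv e x + (u k).deriv e x) / 2| ^ p e) (G.edgeMeasure e) :=
    ((iu.add ik).div_const 2).sub is'
  have iS : Integrable (fun x => |(u n).deriv e x| ^ p e + |(u k).deriv e x| ^ p e)
      (G.edgeMeasure e) := iu.add ik
  have h5 := integral_mono im' ((iS.const_mul ε').add (iD.const_mul C)) fun x =>
    hC ((u n).deriv e x) ((u k).deriv e x)
  simp only [Pi.add_apply] at h5
  rw [integral_add (iS.const_mul ε') (iD.const_mul C), integral_const_mul, integral_const_mul,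
    integral_add iu ik] at h5
  change _ ≤ _ + C * Df e at h5
  have h6 := mul_le_mul_of_nonneg_left (add_le_add (hR n) (hR k)) hε'.le
  linarith

/-- The direct method: the energy attains its minimum. -/
theorem exists_energy_minimizer [Nonempty E] (hp : ∀ e, 1 < p e) (hc : ∀ e, Continuous (γ e))
    (hm : ∀ e, Monotone (γ e)) (hs : ∀ e, Function.Surjective (γ e))
    (hg : ∀ e, Integrable (g e) (G.edgeMeasure e)) :
    ∃ u : G.W1 p, ∀ v : G.W1 p, energy γ g η u ≤ energy γ g η v := by
  have hp0 : ∀ e, 0 < p e := fun e => one_pos.trans (hp e)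
  obtain ⟨C, hC⟩ := exists_le_energy (η := η) hp hc hm hs hg
  have hsum0 : ∀ u : G.W1 p, 0 ≤
      ∑ e, (∫ x, |u.deriv e x| ^ p e ∂G.edgeMeasure e) / (2 * p e) := fun u =>
    Finset.sum_nonneg fun e _ => div_nonneg (integral_nonneg fun x => by positivity)
      (by linarith [hp0 e])
  have hv0 : ∀ u : G.W1 p, 0 ≤ ∑ a, |u.vertexValue a| := fun u =>
    Finset.sum_nonneg fun a _ => abs_nonneg _
  have hzero : Nonempty (G.W1 p) :=
    ⟨W1.ofPrimitive (fun _ _ => 0) (fun _ _ => 0) (fun _ => 0) (fun e => MemLp.zero)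
      (fun e => ⟨intervalIntegrable_const, fun x _ => by simp⟩) (fun _ => rfl) fun _ => rfl⟩
  let S : Set ℝ := range fun u : G.W1 p => energy γ g η u
  have hSb : BddBelow S := ⟨-C, by
    rintro _ ⟨u, rfl⟩
    linarith [hC u, hsum0 u, hv0 u]⟩
  have hSn : S.Nonempty := range_nonempty _
  set m := sInf S
  have hmin : ∀ u : G.W1 p, m ≤ energy γ g η u := fun u => csInf_le hSb (mem_range_self u)
  have hseq : ∀ n : ℕ, ∃ u : G.W1 p, energy γ g η u < m + 1 / ((n : ℝ) + 1) := fun n => by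
    obtain ⟨_, ⟨u, rfl⟩, hu⟩ := exists_lt_of_csInf_lt hSn
      (lt_add_of_pos_right m (by positivity : 0 < 1 / ((n : ℝ) + 1)))
    exact ⟨u, hu⟩
  choose u hu using hseq
  have hulim : Filter.Tendsto (fun n => energy γ g η (u n)) Filter.atTop (𝓝 m) := by
    refine tendsto_of_tendsto_of_tendsto_of_le_of_le tendsto_const_nhds ?_
      (fun n => hmin (u n)) fun n => (hu n).le
    simpa using tendsto_one_div_add_atTop_nhds_zero_nat.const_add m
  have hub : ∀ n, energy γ g η (u n) ≤ m + 1 := fun n => by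
    refine (hu n).le.trans ?_
    have : 1 / ((n : ℝ) + 1) ≤ 1 := by
      rw [div_le_one (by positivity)]; linarith [n.cast_nonneg (α := ℝ)]
    linarith
  set K : ℝ := m + 1 + C
  have hKv : ∀ n, ∑ a, |(u n).vertexValue a| ≤ K := fun n => by
    linarith [hC (u n), hub n, hsum0 (u n)]
  have hKd : ∀ n e, ∫ x, |(u n).deriv e x| ^ p e ∂G.edgeMeasure e ≤ K * (2 * p e) := fun n e => by
    have h2 : 0 < 2 * p e := by linarith [hp0 e]
    rw [← div_le_iff₀ h2]
    refine (Finset.single_le_sum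
      (f := fun e => (∫ x, |(u n).deriv e x| ^ p e ∂G.edgeMeasure e) / (2 * p e))
      (fun e _ => div_nonneg (integral_nonneg fun x => by positivity)
        (by linarith [hp0 e])) (Finset.mem_univ e)).trans ?_
    linarith [hC (u n), hub n, hv0 (u n)]
  choose d hdL hd0 hdp using fun e =>
    exists_tendsto_deriv_of_minimizing hp hc hm hg hmin hulim e fun n => hKd n e
  -- the vertex values converge along a subsequence
  obtain ⟨c, -, k, hk, hkc⟩ := tendsto_subseq_of_bounded
    (Metric.isBounded_closedBall (x := (0 : V → ℝ)) (r := K))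
    (x := fun n => (u n).vertexValue) fun n => by
      rw [mem_closedBall_zero_iff, pi_norm_le_iff_of_nonneg ((hv0 (u n)).trans (hKv n))]
      exact fun a => (Finset.single_le_sum (f := fun a => |(u n).vertexValue a|)
        (fun a _ => abs_nonneg _) (Finset.mem_univ a)).trans (hKv n)
  have hkt := hk.tendsto_atTop
  have hca : ∀ a, Filter.Tendsto (fun n => (u (k n)).vertexValue a) Filter.atTop (𝓝 (c a)) :=
    fun a => (tendsto_pi_nhds.1 hkc) a
  have hdI : ∀ e, IntervalIntegrable (d e) volume 0 (G.length e) := fun e =>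
    intervalIntegrable_of_memLp hp (hdL e)
  have hL1 : ∀ e, Filter.Tendsto
      (fun n => ∫ x, |(u (k n)).deriv e x - d e x| ∂G.edgeMeasure e) Filter.atTop (𝓝 0) := fun e =>
    (tendsto_integral_abs_of_tendsto_rpow (hp e)
      (fun n => ((u n).memLp_deriv e).sub (hdL e)) (hd0 e)).comp hkt
  let f : E → ℝ → ℝ := fun e x => c (G.src e) + ∫ t in (0 : ℝ)..x, d e t
  have hfp : ∀ e, IsPrimitiveOn (G.length e) (f e) (d e) := fun e =>
    ⟨hdI e, fun x _ => by simp [f]⟩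
  let δ : E → ℕ → ℝ := fun e n => |(u (k n)).vertexValue (G.src e) - c (G.src e)| +
    ∫ x, |(u (k n)).deriv e x - d e x| ∂G.edgeMeasure e
  have hδ0 : ∀ e, Filter.Tendsto (δ e) Filter.atTop (𝓝 0) := fun e => by
    have h1 := (tendsto_iff_norm_sub_tendsto_zero.1 (hca (G.src e))).add (hL1 e)
    simpa using h1
  have hδ : ∀ e n, ∀ x ∈ Icc 0 (G.length e), |(u (k n)).toFun e x - f e x| ≤ δ e n := by
    intro e n x hx
    have h1 := (((u (k n)).isPrimitiveOn hp e).add ((hfp e).const_mul (G.length_pos e) (-1))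
      (G.length_pos e)).abs_sub_le hx
    have h2 : f e 0 = c (G.src e) := by simp [f]
    rw [(u (k n)).value_src, h2] at h1
    simp only [neg_one_mul, ← sub_eq_add_neg] at h1
    have h3 := abs_sub_abs_le_abs_sub ((u (k n)).toFun e x - f e x)
      ((u (k n)).vertexValue (G.src e) - c (G.src e))
    simp only [δ]
    linarith
  have htgt : ∀ e, f e (G.length e) = c (G.tgt e) := fun e => by
    have h1 : Filter.Tendsto (fun n => (u (k n)).toFun e (G.length e)) Filter.atTop
        (𝓝 (f e (G.length e))) := by
      rw [tendsto_iff_norm_sub_tendsto_zero]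
      exact squeeze_zero (fun n => norm_nonneg _)
        (fun n => hδ e n _ (right_mem_Icc.2 (G.length_pos e).le)) (hδ0 e)
    simp only [W1.value_tgt] at h1
    exact tendsto_nhds_unique h1 (hca _)
  let w : G.W1 p := W1.ofPrimitive f d c hdL hfp (fun e => by simp [f]) htgt
  have hlim : Filter.Tendsto (fun n => energy γ g η (u (k n))) Filter.atTop
      (𝓝 (energy γ g η w)) := by
    refine (tendsto_finsetSum _ fun e _ => ?_).sub
      (tendsto_finsetSum _ fun a _ => (hca a).const_mul (η a))
    obtain ⟨h1, h2⟩ := tendsto_edge_integrals (u := fun n => u (k n)) (w := w)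
      (continuous_convexPrimitive (hc e)) (hg e) (hδ0 e) (hδ e)
    exact ((((hdp e).comp hkt).div_const _).add h1).sub h2
  have hw : energy γ g η w = m := tendsto_nhds_unique hlim (hulim.comp hkt)
  exact ⟨w, fun v => hw ▸ hmin v⟩

end Minimizer

end MetricGraph

/-! ### The range condition -/

namespace MetricGraph

variable {V E : Type*} {G : MetricGraph V E} {p : E → ℝ}

/-- Convexity bounds the increment of the energy on an edge by the derivative at the far end. -/
theorem edgeEnergy_addMul_sub_le (hp : ∀ e, 1 < p e) (e : E) {γ g : ℝ → ℝ} (hc : Continuous γ)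
    (hm : Monotone γ) (hg : Integrable g (G.edgeMeasure e)) (u φ : G.W1 p) (t : ℝ) :
    edgeEnergy γ g (u.addMul hp t φ) e - edgeEnergy γ g u e ≤
      t * ((∫ x, pFlux (p e) (u.deriv e x + t * φ.deriv e x) * φ.deriv e x ∂G.edgeMeasure e) +
        (∫ x, γ (u.toFun e x + t * φ.toFun e x) * φ.toFun e x ∂G.edgeMeasure e) -
        ∫ x, g x * φ.toFun e x ∂G.edgeMeasure e) := by
  set w := u.addMul hp t φ with hw
  have hwd : ∀ x, u.deriv e x + t * φ.deriv e x = w.deriv e x := fun x => rfl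
  have hwf : ∀ x, u.toFun e x + t * φ.toFun e x = w.toFun e x := fun x => rfl
  simp only [hwd, hwf]
  have iu := integrable_abs_rpow hp (u.memLp_deriv e)
  have iw := integrable_abs_rpow hp (w.memLp_deriv e)
  have iΓ : ∀ z : G.W1 p, Integrable (fun x => convexPrimitive γ (z.toFun e x))
      (G.edgeMeasure e) := fun z => z.integrable_comp e (continuous_convexPrimitive hc)
  have ig : ∀ z : G.W1 p, Integrable (fun x => g x * z.toFun e x) (G.edgeMeasure e) := fun z =>
    integrable_mul_of_continuousOn hg (z.continuousOn e)
  have e1 : (∫ x, |w.deriv e x| ^ p e ∂G.edgeMeasure e) / p e -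
      (∫ x, |u.deriv e x| ^ p e ∂G.edgeMeasure e) / p e ≤
      t * ∫ x, pFlux (p e) (w.deriv e x) * φ.deriv e x ∂G.edgeMeasure e := by
    rw [← integral_div, ← integral_div, ← integral_sub (iw.div_const _) (iu.div_const _),
      ← integral_const_mul]
    refine integral_mono ((iw.div_const _).sub (iu.div_const _))
      ((integrable_pFlux_mul hp (w.memLp_deriv e) (φ.memLp_deriv e)).const_mul t) fun x => ?_
    have h1 := pFlux_mul_sub_le (hp e) (w.deriv e x) (u.deriv e x)
    have h2 : u.deriv e x - w.deriv e x = -(t * φ.deriv e x) := by rw [← hwd]; ring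
    rw [h2] at h1
    simp only
    linarith
  have e2 : (∫ x, convexPrimitive γ (w.toFun e x) ∂G.edgeMeasure e) -
      (∫ x, convexPrimitive γ (u.toFun e x) ∂G.edgeMeasure e) ≤
      t * ∫ x, γ (w.toFun e x) * φ.toFun e x ∂G.edgeMeasure e := by
    rw [← integral_sub (iΓ w) (iΓ u), ← integral_const_mul]
    refine integral_mono ((iΓ w).sub (iΓ u)) ((integrable_mul_of_continuousOn
      (w.integrable_comp e hc) (φ.continuousOn e)).const_mul t) fun x => ?_
    have h1 := mul_sub_le_convexPrimitive hc hm (w.toFun e x) (u.toFun e x)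
    have h2 : u.toFun e x - w.toFun e x = -(t * φ.toFun e x) := by rw [← hwf]; ring
    rw [h2] at h1
    simp only
    linarith
  have e3 : (∫ x, g x * w.toFun e x ∂G.edgeMeasure e) -
      (∫ x, g x * u.toFun e x ∂G.edgeMeasure e) =
      t * ∫ x, g x * φ.toFun e x ∂G.edgeMeasure e := by
    rw [← integral_sub (ig w) (ig u), ← integral_const_mul]
    congr 1
    ext x
    rw [← hwf]
    ring
  unfold edgeEnergy
  linarith

theorem tendsto_integral_pFlux_add_mul (hp : ∀ e, 1 < p e) (e : E) (u φ : G.W1 p) {t : ℕ → ℝ}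
    (ht : Filter.Tendsto t Filter.atTop (𝓝 0)) (ht1 : ∀ n, |t n| ≤ 1) :
    Filter.Tendsto (fun n => ∫ x, pFlux (p e) (u.deriv e x + t n * φ.deriv e x) * φ.deriv e x
      ∂G.edgeMeasure e) Filter.atTop
      (𝓝 (∫ x, pFlux (p e) (u.deriv e x) * φ.deriv e x ∂G.edgeMeasure e)) := by
  have hq : MemLp (fun x => |u.deriv e x| + |φ.deriv e x|) (ENNReal.ofReal (p e))
      (G.edgeMeasure e) := (u.memLp_deriv e).abs.add (φ.memLp_deriv e).abs
  refine tendsto_integral_of_dominated_convergence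
    (fun x => |pFlux (p e) (|u.deriv e x| + |φ.deriv e x|) * φ.deriv e x|)
    (fun n => (integrable_pFlux_mul hp ((u.addMul hp (t n) φ).memLp_deriv e)
      (φ.memLp_deriv e)).1)
    (integrable_pFlux_mul hp hq (φ.memLp_deriv e)).abs
    (fun n => Filter.Eventually.of_forall fun x => ?_)
    (Filter.Eventually.of_forall fun x => ?_)
  · rw [Real.norm_eq_abs, abs_mul, abs_mul, abs_pFlux (hp e), abs_pFlux (hp e)]
    refine mul_le_mul_of_nonneg_right (Real.rpow_le_rpow (abs_nonneg _) ?_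
      (by linarith [hp e])) (abs_nonneg _)
    rw [abs_of_nonneg (add_nonneg (abs_nonneg (u.deriv e x)) (abs_nonneg (φ.deriv e x)))]
    refine (abs_add_le _ _).trans (add_le_add le_rfl ?_)
    rw [abs_mul]
    exact mul_le_of_le_one_left (abs_nonneg _) (ht1 n)
  · have h1 : Filter.Tendsto (fun n => u.deriv e x + t n * φ.deriv e x) Filter.atTop
        (𝓝 (u.deriv e x)) := by
      simpa using (ht.mul_const (φ.deriv e x)).const_add (u.deriv e x)
    exact (((continuous_pFlux (hp e)).tendsto _).comp h1).mul_const _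

theorem tendsto_integral_comp_add_mul (hp : ∀ e, 1 < p e) (e : E) {γ : ℝ → ℝ}
    (hc : Continuous γ) (u φ : G.W1 p) {t : ℕ → ℝ}
    (ht : Filter.Tendsto t Filter.atTop (𝓝 0)) (ht1 : ∀ n, |t n| ≤ 1) :
    Filter.Tendsto (fun n => ∫ x, γ (u.toFun e x + t n * φ.toFun e x) * φ.toFun e x
      ∂G.edgeMeasure e) Filter.atTop
      (𝓝 (∫ x, γ (u.toFun e x) * φ.toFun e x ∂G.edgeMeasure e)) := by
  obtain ⟨R, hR⟩ := isCompact_Icc.exists_bound_of_continuousOn (u.continuousOn e)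
  obtain ⟨R', hR'⟩ := isCompact_Icc.exists_bound_of_continuousOn (φ.continuousOn e)
  obtain ⟨K, hK⟩ := (isCompact_Icc (a := -(R + R')) (b := R + R')).exists_bound_of_continuousOn
    hc.continuousOn
  refine tendsto_integral_of_dominated_convergence (fun x => K * |φ.toFun e x|)
    (fun n => (integrable_mul_of_continuousOn ((u.addMul hp (t n) φ).integrable_comp e hc)
      (φ.continuousOn e)).1)
    ((φ.integrable_comp e continuous_abs).const_mul K) (fun n => ?_)
    (Filter.Eventually.of_forall fun x => ?_)
  · filter_upwards [ae_mem_Icc e] with x hx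
    rw [Real.norm_eq_abs, abs_mul]
    refine mul_le_mul_of_nonneg_right (hK _ (abs_le.1 ?_)) (abs_nonneg _)
    refine (abs_add_le _ _).trans (add_le_add (hR x hx) ?_)
    rw [abs_mul]
    exact (mul_le_of_le_one_left (abs_nonneg _) (ht1 n)).trans (hR' x hx)
  · have h1 : Filter.Tendsto (fun n => u.toFun e x + t n * φ.toFun e x) Filter.atTop
        (𝓝 (u.toFun e x)) := by
      simpa using (ht.mul_const (φ.toFun e x)).const_add (u.toFun e x)
    exact ((hc.tendsto _).comp h1).mul_const _

/-- The element `γ(u)` of `L¹(G)`. -/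
noncomputable def W1.toL1 (u : G.W1 p) {γ : E → ℝ → ℝ} (hc : ∀ e, Continuous (γ e)) : G.L1 :=
  WithLp.toLp 1 fun e => MemLp.toLp (fun x => γ e (u.toFun e x))
    (((hc e).comp_continuousOn (u.continuousOn e)).memLp_Ioo 1)

theorem W1.coeFn_toL1 (u : G.W1 p) {γ : E → ℝ → ℝ} (hc : ∀ e, Continuous (γ e)) (e : E) :
    u.toL1 hc e =ᵐ[G.edgeMeasure e] fun x => γ e (u.toFun e x) :=
  MemLp.coeFn_toLp (((hc e).comp_continuousOn (u.continuousOn e)).memLp_Ioo 1)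

variable [Fintype V] [Fintype E]

/-- The Euler-Lagrange inequality at a minimizer, in the direction `φ`. -/
theorem euler_lagrange_nonneg (hp : ∀ e, 1 < p e) {γ g : E → ℝ → ℝ} {η : V → ℝ}
    (hc : ∀ e, Continuous (γ e)) (hm : ∀ e, Monotone (γ e))
    (hg : ∀ e, Integrable (g e) (G.edgeMeasure e)) {u : G.W1 p}
    (hu : ∀ v : G.W1 p, energy γ g η u ≤ energy γ g η v) (φ : G.W1 p) :
    0 ≤ (∑ e, ((∫ x, pFlux (p e) (u.deriv e x) * φ.deriv e x ∂G.edgeMeasure e) +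
        (∫ x, γ e (u.toFun e x) * φ.toFun e x ∂G.edgeMeasure e) -
        ∫ x, g e x * φ.toFun e x ∂G.edgeMeasure e)) - ∑ a, η a * φ.vertexValue a := by
  let t : ℕ → ℝ := fun n => 1 / ((n : ℝ) + 1)
  have ht : Filter.Tendsto t Filter.atTop (𝓝 0) := tendsto_one_div_add_atTop_nhds_zero_nat
  have ht0 : ∀ n, 0 < t n := fun n => by simp only [t]; positivity
  have ht1 : ∀ n, |t n| ≤ 1 := fun n => by
    rw [abs_of_pos (ht0 n)]
    simp only [t]
    rw [div_le_one (by positivity)]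
    linarith [n.cast_nonneg (α := ℝ)]
  refine ge_of_tendsto' ((tendsto_finsetSum _ fun e _ =>
    ((tendsto_integral_pFlux_add_mul hp e u φ ht ht1).add
      (tendsto_integral_comp_add_mul hp e (hc e) u φ ht ht1)).sub_const _).sub_const _)
      fun n => ?_
  have h1 := hu (u.addMul hp (t n) φ)
  have h2 := Finset.sum_le_sum fun e (_ : e ∈ Finset.univ) =>
    edgeEnergy_addMul_sub_le hp e (hc e) (hm e) (hg e) u φ (t n)
  rw [Finset.sum_sub_distrib, ← Finset.mul_sum] at h2
  have h3 : ∑ a, η a * (u.addMul hp (t n) φ).vertexValue a =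
      ∑ a, η a * u.vertexValue a + t n * ∑ a, η a * φ.vertexValue a := by
    rw [Finset.mul_sum, ← Finset.sum_add_distrib]
    refine Finset.sum_congr rfl fun a _ => ?_
    change η a * (u.vertexValue a + t n * φ.vertexValue a) = _
    ring
  unfold energy at h1
  rw [h3] at h1
  refine nonneg_of_mul_nonneg_right (?_ : 0 ≤ t n * _) (ht0 n)
  rw [mul_sub]
  linarith

/-- Existence of a solution of `-Δ_p u + γ(u) = g` on the edges with flux `η` at the vertices. -/
theorem exists_solvesFlux [Nonempty E] (hp : ∀ e, 1 < p e) {γ g : E → ℝ → ℝ} {η : V → ℝ}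
    (hc : ∀ e, Continuous (γ e)) (hm : ∀ e, Monotone (γ e))
    (hs : ∀ e, Function.Surjective (γ e)) (hg : ∀ e, Integrable (g e) (G.edgeMeasure e)) :
    ∃ u : G.W1 p, SolvesFlux u (fun e x => g e x - γ e (u.toFun e x)) η := by
  obtain ⟨u, hu⟩ := exists_energy_minimizer (η := η) hp hc hm hs hg
  refine ⟨u, fun φ => ?_⟩
  have h1 := euler_lagrange_nonneg hp hc hm hg hu φ
  -- the direction `-φ`, written as `φ - 2 φ`
  have h2 := euler_lagrange_nonneg hp hc hm hg hu (φ.addMul hp (-2) φ)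
  have hd : ∀ e x, (φ.addMul hp (-2) φ).deriv e x = -φ.deriv e x := fun e x => by
    change φ.deriv e x + -2 * φ.deriv e x = _
    ring
  have hf : ∀ e x, (φ.addMul hp (-2) φ).toFun e x = -φ.toFun e x := fun e x => by
    change φ.toFun e x + -2 * φ.toFun e x = _
    ring
  have hv : ∀ a, (φ.addMul hp (-2) φ).vertexValue a = -φ.vertexValue a := fun a => by
    change φ.vertexValue a + -2 * φ.vertexValue a = _
    ring
  simp only [hd, hf, hv, mul_neg, integral_neg, Finset.sum_neg_distrib, sub_neg_eq_add,
    ← neg_add, Finset.sum_add_distrib, Finset.sum_sub_distrib] at h1 h2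
  have h3 : ∑ e, ∫ x, (g e x - γ e (u.toFun e x)) * φ.toFun e x ∂G.edgeMeasure e =
      ∑ e, ∫ x, g e x * φ.toFun e x ∂G.edgeMeasure e -
        ∑ e, ∫ x, γ e (u.toFun e x) * φ.toFun e x ∂G.edgeMeasure e := by
    rw [← Finset.sum_sub_distrib]
    refine Finset.sum_congr rfl fun e _ => ?_
    rw [← integral_sub (integrable_mul_of_continuousOn (hg e) (φ.continuousOn e))
      (integrable_mul_of_continuousOn (u.integrable_comp e (hc e)) (φ.continuousOn e))]
    simp only [sub_mul]
  rw [h3]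
  linarith

/-- Solvability of the resolvent equation. -/
theorem exists_resolvent [Nonempty E] (hp : ∀ e, 1 < p e) {γ : E → ℝ → ℝ}
    (hc : ∀ e, Continuous (γ e)) (hm : ∀ e, Monotone (γ e))
    (hs : ∀ e, Function.Surjective (γ e)) {lam : ℝ} (hlam : 0 < lam) (g : G.L1) (η : V → ℝ) :
    ∃ u : G.W1 p, SolvesFlux u (fun e => (lam⁻¹ • (g - u.toL1 hc)) e) fun a => lam⁻¹ * η a := by
  have hl : 0 < lam⁻¹ := inv_pos.2 hlam
  obtain ⟨u, hu⟩ := exists_solvesFlux (G := G) (γ := fun e s => lam⁻¹ * γ e s)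
    (g := fun e x => lam⁻¹ * g e x) (η := fun a => lam⁻¹ * η a) hp
    (fun e => continuous_const.mul (hc e)) (fun e s t h => mul_le_mul_of_nonneg_left (hm e h) hl.le)
    (fun e s => by
      obtain ⟨t, ht⟩ := hs e (lam * s)
      exact ⟨t, by simp only [ht]; rw [inv_mul_cancel_left₀ hlam.ne']⟩)
    fun e => (g.integrable e).const_mul _
  refine ⟨u, fun φ => (hu φ).trans ?_⟩
  congr 1
  refine Finset.sum_congr rfl fun e _ => integral_congr_ae ?_
  filter_upwards [u.coeFn_toL1 hc e, Lp.coeFn_sub (g e) (u.toL1 hc e),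
    Lp.coeFn_smul lam⁻¹ (g e - u.toL1 hc e)] with x h1 h2 h3
  have : (lam⁻¹ • (g - u.toL1 hc)) e x = lam⁻¹ * (g e x - γ e (u.toFun e x)) := by
    refine h3.trans ?_
    rw [Pi.smul_apply, h2, Pi.sub_apply, h1, smul_eq_mul]
  rw [this]
  ring

theorem mem_opA (u : G.W1 p) {γ : E → ℝ → ℝ} (hc : ∀ e, Continuous (γ e)) {f : G.L1}
    {w : PiLp 1 fun _ : V => ℝ} (h : SolvesFlux u (fun e => f e) w) :
    ((WithLp.toLp 1 (u.toL1 hc, 0), WithLp.toLp 1 (f, w)) : G.X × G.X) ∈ G.opA p γ :=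
  ⟨u.toL1 hc, f, w, rfl, isWeakSolution_add_iff.2 ⟨u, u.coeFn_toL1 hc, h⟩⟩

theorem rangeCondition_opA [Nonempty E] (hp : ∀ e, 1 < p e) {γ : E → ℝ → ℝ}
    (hc : ∀ e, Continuous (γ e)) (hm : ∀ e, Monotone (γ e))
    (hs : ∀ e, Function.Surjective (γ e)) : NonlinearOperator.RangeCondition (G.opA p γ) := by
  rintro lam hlam ⟨g, η⟩
  obtain ⟨u, hu⟩ := exists_resolvent hp hc hm hs hlam g η
  refine ⟨_, mem_opA u hc (f := lam⁻¹ • (g - u.toL1 hc)) (w := lam⁻¹ • η) hu, ?_⟩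
  change (WithLp.toLp 1 (u.toL1 hc + lam • lam⁻¹ • (g - u.toL1 hc),
    0 + lam • lam⁻¹ • η) : G.X) = WithLp.toLp 1 (g, η)
  rw [smul_inv_smul₀ hlam.ne', smul_inv_smul₀ hlam.ne', zero_add, add_sub_cancel]

end MetricGraph

/-! ### Density of the domain -/

/-- For a nondecreasing continuous `γ`, the increments of `γ` are controlled in the mean by
the monotone form `(γ(s) - γ(t)) (s - t)`, locally uniformly in `t`. -/
theorem exists_abs_sub_le_add_mul {γ : ℝ → ℝ} (hc : Continuous γ) (hm : Monotone γ) (M : ℝ)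
    {ε : ℝ} (hε : 0 < ε) : ∃ C, 0 ≤ C ∧ ∀ s t, |t| ≤ M →
      |γ s - γ t| ≤ ε + C * ((γ s - γ t) * (s - t)) := by
  have hu : UniformContinuousOn γ (Icc (-(M + 1)) (M + 1)) :=
    isCompact_Icc.uniformContinuousOn_of_continuous hc.continuousOn
  obtain ⟨δ, hδ, H⟩ := Metric.uniformContinuousOn_iff.1 hu ε hε
  set r := min δ 1 with hr
  have hr0 : 0 < r := lt_min hδ one_pos
  -- close to `t` uniform continuity applies; at distance at least `r` the product dominates
  have hmul : ∀ s t, (γ s - γ t) * (s - t) = |γ s - γ t| * |s - t| := fun s t => by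
    rcases le_total s t with h | h
    · rw [abs_of_nonpos (sub_nonpos.2 (hm h)), abs_of_nonpos (sub_nonpos.2 h), neg_mul_neg]
    · rw [abs_of_nonneg (sub_nonneg.2 (hm h)), abs_of_nonneg (sub_nonneg.2 h)]
  refine ⟨r⁻¹, by positivity, fun s t ht => ?_⟩
  rw [hmul]
  rcases lt_or_ge |s - t| r with h | h
  · have h1 : |s| ≤ M + 1 := by
      linarith [abs_sub_abs_le_abs_sub s t, min_le_right δ 1]
    have h2 := H s (abs_le.1 h1) t (abs_le.1 (by linarith)) (by
      rw [Real.dist_eq]; exact h.trans_le (min_le_left _ _))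
    rw [Real.dist_eq] at h2
    have : 0 ≤ r⁻¹ * (|γ s - γ t| * |s - t|) := by positivity
    linarith
  · have h1 : |γ s - γ t| * r ≤ |γ s - γ t| * |s - t| := by gcongr
    have h2 : |γ s - γ t| ≤ r⁻¹ * (|γ s - γ t| * |s - t|) := by
      rw [inv_mul_eq_div, le_div_iff₀ hr0]
      exact h1
    linarith

theorem neg_abs_rpow_le_pFlux_mul_sub {p : ℝ} (hp : 1 < p) (a b : ℝ) :
    -(|b| ^ p) ≤ pFlux p a * (a - b) := by
  have h1 := pFlux_mul_sub_le hp a b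
  have h2 : 0 ≤ |a| ^ p / p := by positivity
  have h3 : |b| ^ p / p ≤ |b| ^ p := div_le_self (by positivity) hp.le
  linarith

/-- The functions `γ(h)`, with `h` continuously differentiable and vanishing at the end points, are
dense in `L¹(0, ℓ)`. -/
theorem exists_contDiff_integral_abs_sub_lt {ℓ : ℝ} {γ : ℝ → ℝ} (hc : Continuous γ)
    (hm : StrictMono γ) (hs : Function.Surjective γ) {f : ℝ → ℝ}
    (hf : Integrable f (volume.restrict (Ioo 0 ℓ))) {ε : ℝ} (hε : 0 < ε) :
    ∃ h : ℝ → ℝ, ContDiff ℝ 1 h ∧ h 0 = 0 ∧ h ℓ = 0 ∧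
      ∫ x in Ioo 0 ℓ, |f x - γ (h x)| < ε := by
  obtain ⟨g, hg, hgI⟩ := hf.exists_boundedContinuous_integral_sub_le (half_pos hε)
  let φ : ℝ ≃o ℝ := hm.orderIsoOfSurjective γ hs
  have hφ : ∀ s, γ (φ.symm s) = s := fun s => φ.apply_symm_apply s
  let k : ℝ → ℝ := fun x => φ.symm (g x)
  have hk : Continuous k := φ.symm.continuous.comp g.continuous
  obtain ⟨R, hR⟩ := (isCompact_Icc (a := 0) (b := ℓ)).exists_bound_of_continuousOn hk.continuousOn
  choose q hq using fun n : ℕ => exists_polynomial_near_of_continuousOn 0 ℓ k hk.continuousOn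
    (1 / ((n : ℝ) + 1)) (by positivity)
  -- a smooth cutoff, equal to `1` away from the end points
  let χ : ℕ → ℝ → ℝ := fun n x =>
    Real.smoothTransition (n * x) * Real.smoothTransition (n * (ℓ - x))
  have hχ : ∀ n, ContDiff ℝ 1 (χ n) := fun n =>
    (Real.smoothTransition.contDiff.comp (contDiff_const.mul contDiff_id)).mul
      (Real.smoothTransition.contDiff.comp (contDiff_const.mul (contDiff_const.sub contDiff_id)))
  let h : ℕ → ℝ → ℝ := fun n x => χ n x * (q n).eval x
  have hh : ∀ n, ContDiff ℝ 1 (h n) := fun n => (hχ n).mul (by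
    simpa only [Polynomial.coe_aeval_eq_eval] using (q n).contDiff_aeval (𝕜 := ℝ) 1)
  have hχ1 : ∀ n x, |χ n x| ≤ 1 := fun n x => by
    rw [abs_of_nonneg (mul_nonneg (Real.smoothTransition.nonneg _)
      (Real.smoothTransition.nonneg _))]
    exact mul_le_one₀ (Real.smoothTransition.le_one _) (Real.smoothTransition.nonneg _)
      (Real.smoothTransition.le_one _)
  have hhb : ∀ n, ∀ x ∈ Icc 0 ℓ, |h n x| ≤ R + 1 := fun n x hx => by
    have h1 : 1 / ((n : ℝ) + 1) ≤ 1 := by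
      rw [div_le_one (by positivity)]; linarith [n.cast_nonneg (α := ℝ)]
    have h2 := hR x hx
    rw [Real.norm_eq_abs] at h2
    have h3 : |(q n).eval x| ≤ R + 1 := by
      linarith [abs_sub_abs_le_abs_sub ((q n).eval x) (k x), hq n x hx]
    simp only [h]
    rw [abs_mul]
    exact (mul_le_of_le_one_left (abs_nonneg _) (hχ1 n x)).trans h3
  obtain ⟨K, hK⟩ := (isCompact_Icc (a := -(R + 1)) (b := R + 1)).exists_bound_of_continuousOn
    hc.continuousOn
  have hae : ∀ᵐ x ∂volume.restrict (Ioo 0 ℓ), x ∈ Ioo 0 ℓ := ae_restrict_mem measurableSet_Ioo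
  have hlim : Filter.Tendsto (fun n => ∫ x in Ioo 0 ℓ, |g x - γ (h n x)|) Filter.atTop
      (𝓝 (∫ x in Ioo 0 ℓ, (0 : ℝ))) := by
    refine tendsto_integral_of_dominated_convergence (fun x => |g x| + K)
      (fun n => (g.continuous.sub (hc.comp (hh n).continuous)).abs.aestronglyMeasurable)
      (hgI.abs.add (integrable_const _)) (fun n => ?_) ?_
    · filter_upwards [hae] with x hx
      rw [Real.norm_eq_abs, abs_abs]
      have h1 := hK _ (abs_le.1 (hhb n x (Ioo_subset_Icc_self hx)))
      rw [Real.norm_eq_abs] at h1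
      linarith [abs_sub (g x) (γ (h n x))]
    · filter_upwards [hae] with x hx
      have h1 : Filter.Tendsto (fun n => (q n).eval x) Filter.atTop (𝓝 (k x)) := by
        rw [tendsto_iff_norm_sub_tendsto_zero]
        exact squeeze_zero (fun n => norm_nonneg _)
          (fun n => (hq n x (Ioo_subset_Icc_self hx)).le) tendsto_one_div_add_atTop_nhds_zero_nat
      have h2 : ∀ y : ℝ, 0 < y → ∀ᶠ n : ℕ in Filter.atTop,
          Real.smoothTransition (n * y) = 1 := fun y hy => by
        obtain ⟨N, hN⟩ := exists_nat_ge y⁻¹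
        filter_upwards [Filter.eventually_ge_atTop N] with n hn
        refine Real.smoothTransition.one_of_one_le ((inv_le_iff_one_le_mul₀ hy).1 ?_)
        exact hN.trans (by exact_mod_cast hn)
      have h3 : Filter.Tendsto (fun n => h n x) Filter.atTop (𝓝 (k x)) := by
        refine h1.congr' ?_
        filter_upwards [h2 x hx.1, h2 (ℓ - x) (sub_pos.2 hx.2)] with n h4 h5
        simp only [h, χ, h4, h5, one_mul]
      have h4 : Filter.Tendsto (fun n => |g x - γ (h n x)|) Filter.atTop
          (𝓝 |g x - γ (k x)|) := (((hc.tendsto _).comp h3).const_sub _).abs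
      simpa only [k, hφ, sub_self, abs_zero] using h4
  rw [integral_zero] at hlim
  obtain ⟨n, hn⟩ := (hlim.eventually_lt_const (half_pos hε)).exists
  refine ⟨h n, hh n, by simp [h, χ], by simp [h, χ], ?_⟩
  have hγI : Integrable (fun x => γ (h n x)) (volume.restrict (Ioo 0 ℓ)) :=
    memLp_one_iff_integrable.1 ((hc.comp (hh n).continuous).continuousOn.memLp_Ioo 1)
  have i1 : Integrable (fun x => |f x - g x|) (volume.restrict (Ioo 0 ℓ)) := (hf.sub hgI).abs
  have i2 : Integrable (fun x => |g x - γ (h n x)|) (volume.restrict (Ioo 0 ℓ)) :=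
    (hgI.sub hγI).abs
  have h5 : ∫ x in Ioo 0 ℓ, |f x - γ (h n x)| ≤
      ∫ x in Ioo 0 ℓ, (|f x - g x| + |g x - γ (h n x)|) :=
    integral_mono (hf.sub hγI).abs (i1.add i2) fun x => abs_sub_le _ _ _
  rw [integral_add i1 i2] at h5
  simp only [Real.norm_eq_abs] at hg
  linarith

namespace MetricGraph

variable {V E : Type*} {G : MetricGraph V E} {p : E → ℝ}

theorem L1.norm_sub_eq [Fintype E] (v v' : G.L1) :
    ‖v - v'‖ = ∑ e, ∫ x, |v e x - v' e x| ∂G.edgeMeasure e := by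
  rw [PiLp.norm_eq_of_L1]
  refine Finset.sum_congr rfl fun e _ => ?_
  change ‖v e - v' e‖ = _
  rw [L1.norm_eq_integral_norm]
  refine integral_congr_ae ?_
  filter_upwards [Lp.coeFn_sub (v e) (v' e)] with x hx
  rw [hx, Pi.sub_apply, Real.norm_eq_abs]

theorem exists_W1_norm_sub_toL1_lt [Fintype E] {γ : E → ℝ → ℝ}
    (hc : ∀ e, Continuous (γ e)) (hm : ∀ e, StrictMono (γ e))
    (hs : ∀ e, Function.Surjective (γ e)) (v : G.L1) {ε : ℝ} (hε : 0 < ε) :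
    ∃ h : G.W1 p, ‖v - h.toL1 hc‖ < ε := by
  let N : ℝ := Fintype.card E + 1
  have hN : 0 < N := by positivity
  choose h hh h0 hℓ hlt using fun e => exists_contDiff_integral_abs_sub_lt (hc e) (hm e) (hs e)
    (v.integrable e) (div_pos hε hN)
  let u : G.W1 p := W1.ofPrimitive h (fun e => deriv (h e)) (fun _ => 0)
    (fun e => ((hh e).continuous_deriv le_rfl).continuousOn.memLp_Ioo _)
    (fun e => .of_contDiff (G.length_pos e) (hh e)) h0 hℓ
  refine ⟨u, ?_⟩
  rw [L1.norm_sub_eq]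
  have h1 : ∀ e, ∫ x, |v e x - u.toL1 hc e x| ∂G.edgeMeasure e ≤ ε / N := fun e => by
    refine le_of_eq_of_le (integral_congr_ae ?_) (hlt e).le
    filter_upwards [u.coeFn_toL1 hc e] with x hx
    rw [hx]
    rfl
  refine (Finset.sum_le_sum fun e _ => h1 e).trans_lt ?_
  rw [Finset.sum_const, Finset.card_univ, nsmul_eq_mul, mul_div_assoc', div_lt_iff₀ hN]
  have : (Fintype.card E : ℝ) * ε + ε = ε * N := by simp only [N]; ring
  linarith

variable [Fintype V] [Fintype E]

/-- The energy estimate for the resolvent of `γ(h)`: testing the equation with `u - h`. -/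
theorem SolvesFlux.sum_integral_mul_sub_le (hp : ∀ e, 1 < p e) {γ : E → ℝ → ℝ}
    (hc : ∀ e, Continuous (γ e)) {lam : ℝ} (hlam : 0 < lam) {u h : G.W1 p}
    (hu : SolvesFlux u (fun e => (lam⁻¹ • (h.toL1 hc - u.toL1 hc)) e) 0) :
    ∑ e, ∫ x, (γ e (u.toFun e x) - γ e (h.toFun e x)) * (u.toFun e x - h.toFun e x)
      ∂G.edgeMeasure e ≤ lam * ∑ e, ∫ x, |h.deriv e x| ^ p e ∂G.edgeMeasure e := by
  let φ : G.W1 p := u.addMul hp (-1) h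
  have hφ : ∀ e x, φ.toFun e x = u.toFun e x - h.toFun e x := fun e x => by
    change u.toFun e x + -1 * h.toFun e x = _
    ring
  have hφd : ∀ e x, φ.deriv e x = u.deriv e x - h.deriv e x := fun e x => by
    change u.deriv e x + -1 * h.deriv e x = _
    ring
  have h1 := hu φ
  have h2 : ∀ e, ∫ x, (lam⁻¹ • (h.toL1 hc - u.toL1 hc)) e x * φ.toFun e x ∂G.edgeMeasure e =
      -(lam⁻¹ * ∫ x, (γ e (u.toFun e x) - γ e (h.toFun e x)) * (u.toFun e x - h.toFun e x)
        ∂G.edgeMeasure e) := fun e => by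
    rw [← integral_const_mul, ← integral_neg]
    refine integral_congr_ae ?_
    filter_upwards [u.coeFn_toL1 hc e, h.coeFn_toL1 hc e,
      Lp.coeFn_sub (h.toL1 hc e) (u.toL1 hc e),
      Lp.coeFn_smul lam⁻¹ (h.toL1 hc e - u.toL1 hc e)] with x h3 h4 h5 h6
    have h7 : (lam⁻¹ • (h.toL1 hc - u.toL1 hc)) e x =
        lam⁻¹ * (γ e (h.toFun e x) - γ e (u.toFun e x)) := by
      refine h6.trans ?_
      rw [Pi.smul_apply, h5, Pi.sub_apply, h3, h4, smul_eq_mul]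
    rw [h7, hφ]
    ring
  have h3 : -∑ e, ∫ x, |h.deriv e x| ^ p e ∂G.edgeMeasure e ≤
      ∑ e, ∫ x, pFlux (p e) (u.deriv e x) * φ.deriv e x ∂G.edgeMeasure e := by
    rw [← Finset.sum_neg_distrib]
    refine Finset.sum_le_sum fun e _ => ?_
    rw [← integral_neg]
    refine integral_mono (integrable_abs_rpow hp (h.memLp_deriv e)).neg
      (integrable_pFlux_mul hp (u.memLp_deriv e) (φ.memLp_deriv e)) fun x => ?_
    simp only [hφd]
    exact neg_abs_rpow_le_pFlux_mul_sub (hp e) _ _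
  rw [h1] at h3
  simp only [h2, Finset.sum_neg_distrib, ← Finset.mul_sum, Pi.zero_apply, zero_mul,
    Finset.sum_const_zero, add_zero] at h3
  rw [neg_le_neg_iff, inv_mul_eq_div, div_le_iff₀ hlam] at h3
  linarith

/-- `(γ(h), 0)` is the limit, as `λ → 0`, of its images under the resolvents `(I + λ 𝒜)⁻¹`. -/
theorem toL1_mem_closure_domain [Nonempty E] (hp : ∀ e, 1 < p e) {γ : E → ℝ → ℝ}
    (hc : ∀ e, Continuous (γ e)) (hm : ∀ e, Monotone (γ e))
    (hs : ∀ e, Function.Surjective (γ e)) (h : G.W1 p) :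
    (WithLp.toLp 1 (h.toL1 hc, 0) : G.X) ∈
      closure (NonlinearOperator.domain (G.opA p γ)) := by
  rw [Metric.mem_closure_iff]
  intro ε hε
  choose M hM using fun e => isCompact_Icc.exists_bound_of_continuousOn (h.continuousOn e)
  set L : ℝ := ∑ e, G.length e
  have hL : 0 ≤ L := Finset.sum_nonneg fun e _ => (G.length_pos e).le
  let ε' : ℝ := ε / (2 * (L + 1))
  have hε' : 0 < ε' := by positivity
  have hε'L : ε' * L < ε / 2 := by
    have : ε' * (L + 1) = ε / 2 := by simp only [ε']; field_simp
    nlinarith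
  choose C hC0 hC using fun e => exists_abs_sub_le_add_mul (hc e) (hm e) (M e) hε'
  set S : ℝ := ∑ e, C e
  have hS : 0 ≤ S := Finset.sum_nonneg fun e _ => hC0 e
  set K : ℝ := ∑ e, ∫ x, |h.deriv e x| ^ p e ∂G.edgeMeasure e
  have hK : 0 ≤ K := Finset.sum_nonneg fun e _ => integral_nonneg fun x => by positivity
  let lam : ℝ := ε / (2 * (S * K + 1))
  have hlam : 0 < lam := by positivity
  have hlamK : S * (lam * K) < ε / 2 := by
    have : lam * (S * K + 1) = ε / 2 := by simp only [lam]; field_simp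
    linarith
  obtain ⟨u, hu⟩ := exists_resolvent hp hc hm hs hlam (h.toL1 hc) 0
  have hu' : SolvesFlux u (fun e => (lam⁻¹ • (h.toL1 hc - u.toL1 hc)) e) 0 := by
    simpa only [Pi.zero_apply, mul_zero] using! hu
  refine ⟨WithLp.toLp 1 (u.toL1 hc, 0), ⟨_, mem_opA u hc (w := 0) hu'⟩, ?_⟩
  let Q : E → ℝ := fun e => ∫ x, (γ e (u.toFun e x) - γ e (h.toFun e x)) *
    (u.toFun e x - h.toFun e x) ∂G.edgeMeasure e
  have hQ0 : ∀ e, 0 ≤ Q e := fun e => integral_nonneg fun x => by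
    rcases le_total (u.toFun e x) (h.toFun e x) with h1 | h1
    · exact mul_nonneg_of_nonpos_of_nonpos (sub_nonpos.2 (hm e h1)) (sub_nonpos.2 h1)
    · exact mul_nonneg (sub_nonneg.2 (hm e h1)) (sub_nonneg.2 h1)
  have hQ : ∑ e, Q e ≤ lam * K := hu'.sum_integral_mul_sub_le hp hc hlam
  have hedge : ∀ e, ∫ x, |u.toL1 hc e x - h.toL1 hc e x| ∂G.edgeMeasure e ≤
      ε' * G.length e + C e * Q e := fun e => by
    have i1 : Integrable (fun x => γ e (u.toFun e x) - γ e (h.toFun e x)) (G.edgeMeasure e) :=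
      (u.integrable_comp e (hc e)).sub (h.integrable_comp e (hc e))
    have i2 : Integrable (fun x => (γ e (u.toFun e x) - γ e (h.toFun e x)) *
        (u.toFun e x - h.toFun e x)) (G.edgeMeasure e) :=
      integrable_mul_of_continuousOn i1 ((u.continuousOn e).sub (h.continuousOn e))
    have h1 : ∫ x, |u.toL1 hc e x - h.toL1 hc e x| ∂G.edgeMeasure e =
        ∫ x, |γ e (u.toFun e x) - γ e (h.toFun e x)| ∂G.edgeMeasure e := by
      refine integral_congr_ae ?_
      filter_upwards [u.coeFn_toL1 hc e, h.coeFn_toL1 hc e] with x h3 h4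
      rw [h3, h4]
    rw [h1]
    refine (integral_mono_ae i1.abs ((integrable_const ε').add (i2.const_mul (C e))) ?_).trans_eq
      (?_ : ∫ x, (ε' + C e * ((γ e (u.toFun e x) - γ e (h.toFun e x)) *
        (u.toFun e x - h.toFun e x))) ∂G.edgeMeasure e = _)
    · filter_upwards [ae_mem_Icc e] with x hx
      exact hC e _ _ (hM e x hx)
    · rw [integral_add (integrable_const _) (i2.const_mul _), integral_const_edge,
        integral_const_mul, mul_comm (G.length e)]
  have hnorm : dist (WithLp.toLp 1 (h.toL1 hc, 0) : G.X) (WithLp.toLp 1 (u.toL1 hc, 0)) =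
      ‖u.toL1 hc - h.toL1 hc‖ := by
    rw [dist_comm, dist_eq_norm, WithLp.prod_norm_eq_of_L1]
    change ‖u.toL1 hc - h.toL1 hc‖ + ‖(0 : PiLp 1 fun _ : V => ℝ) - 0‖ = _
    rw [sub_zero, norm_zero, add_zero]
  rw [hnorm, L1.norm_sub_eq]
  have h1 := Finset.sum_le_sum fun e (_ : e ∈ Finset.univ) => hedge e
  rw [Finset.sum_add_distrib, ← Finset.mul_sum] at h1
  have h2 : ∑ e, C e * Q e ≤ S * ∑ e, Q e := by
    rw [Finset.mul_sum]
    exact Finset.sum_le_sum fun e _ => mul_le_mul_of_nonneg_right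
      (Finset.single_le_sum (fun e _ => hC0 e) (Finset.mem_univ e)) (hQ0 e)
  have h3 := mul_le_mul_of_nonneg_left hQ hS
  linarith

theorem closure_domain_opA [Nonempty E] (hp : ∀ e, 1 < p e) {γ : E → ℝ → ℝ}
    (hc : ∀ e, Continuous (γ e)) (hm : ∀ e, StrictMono (γ e))
    (hs : ∀ e, Function.Surjective (γ e)) :
    closure (NonlinearOperator.domain (G.opA p γ)) =
      {x : G.X | ∃ v : G.L1, x = WithLp.toLp 1 (v, 0)} := by
  refine Subset.antisymm (closure_minimal ?_ ?_) ?_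
  · rintro _ ⟨y, v, v', w, h, _⟩
    exact ⟨v, congrArg Prod.fst h⟩
  · have h1 : {x : G.X | ∃ v : G.L1, x = WithLp.toLp 1 (v, 0)} = {x : G.X | x.snd = 0} := by
      ext x
      constructor
      · rintro ⟨v, rfl⟩
        rfl
      · intro hx
        refine ⟨x.fst, ?_⟩
        have hx' : x.snd = 0 := hx
        rw [← hx']
        rfl
    rw [h1]
    exact isClosed_eq (WithLp.continuous_snd ..) continuous_const
  · rintro _ ⟨v, rfl⟩
    rw [← closure_closure, Metric.mem_closure_iff]
    intro ε hε
    obtain ⟨h, hh⟩ := exists_W1_norm_sub_toL1_lt (p := p) hc hm hs v hε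
    refine ⟨_, toL1_mem_closure_domain hp hc (fun e => (hm e).monotone) hs h, ?_⟩
    rw [dist_eq_norm, WithLp.prod_norm_eq_of_L1]
    change ‖v - h.toL1 hc‖ + ‖(0 : PiLp 1 fun _ : V => ℝ) - 0‖ < ε
    rwa [sub_zero, norm_zero, add_zero]

end MetricGraph

theorem mainTheorem3 {V E : Type*} [Fintype V] [Fintype E] [Nonempty E]
    (G : MetricGraph V E) (p : E → ℝ) (hp : ∀ e, 1 < p e)
    (γ : E → ℝ → ℝ) (hγ_cont : ∀ e, Continuous (γ e)) (hγ_mono : ∀ e, StrictMono (γ e))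
    (hγ_surj : ∀ e, Function.Surjective (γ e)) (hγ_zero : ∀ e, γ e 0 = 0) :
    NonlinearOperator.IsMTAccretive (G.opA p γ) ∧
      closure (NonlinearOperator.domain (G.opA p γ)) =
        {x : G.X | ∃ v : G.L1, x = WithLp.toLp 1 (v, 0)} :=
  ⟨⟨⟨MetricGraph.isAccretive_opA hp hγ_mono,
    MetricGraph.rangeCondition_opA hp hγ_cont (fun e => (hγ_mono e).monotone) hγ_surj⟩,
    MetricGraph.isTAccretive_opA hp hγ_mono⟩,
    MetricGraph.closure_domain_opA hp hγ_cont hγ_mono hγ_surj⟩
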